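/- Let $G$ be a rooted directed graph with nodes $0,1,\dots,N$ ($N\ge 1$, root $0$), edge set $E$ and weights $w_{ij}\ge 0$ with $w_{ij}=0$ for $(i\to j)\notin E$. A dependency tree of $G$ is a set $t\subseteq E$ without directed cycles in which every non-root node has exactly one incoming edge and exactly one edge leaves the root; its weight is $\prod_{(i\to j)\in t}w_{ij}$, and $Z$ is the sum of the weights of all dependency trees of $G$. The root-constrained Laplacian $L\in\mathbb{R}^{N\times N}$ of $G$ is given by $$L_{ij}=\begin{cases} w_{0j} & i=1,\\ \sum_{i'\in\{1,\dots,N\}\setminus\{i\}} w_{i'j} & i=j\neq 1,\\ -w_{ij} & \text{otherwise.}\end{cases}$$ The weighted ancestral sampler is the following randomized algorithm, in exact real arithmetic. Compute $L$ and $B=L^{-\top}$ (by Gauss–Jordan elimination with pivoting). Then, for $j=1,\dots,N$ in turn: compute $m_0=w_{0j}B_{1j}$ and, for $i\in\{1,\dots,N\}\setminus\{j\}$, $m_i=w_{ij}([j\ne 1]B_{jj}-[i\ne 1]B_{ij})$; draw $i$ with probability $m_i$ and output the edge $i\to j$; and condition on this edge, that is, with $c=w_{0j}e_1$ if $i=0$,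 $c=w_{ij}([j\ne1]e_j-[i\ne1]e_i)$ otherwise, and $u=c-L_{[:,j]}$, replace $$L_{[:,j]}\leftarrow L_{[:,j]}+u,\qquad B\leftarrow B-\frac{B_{[:,j]}\,u^\top B}{1+u^\top B_{[:,j]}}.$$ **Theorem.** (1) There is a universal constant $K$ such that, for every $N\ge1$ and every such graph, every run of the algorithm takes at most $K N^3$ steps, where arithmetic operations, comparisons, memory accesses and loop iterations cost $O(1)$ steps each and drawing from a given probability vector costs a number of steps linear in its length. (2) $Z=\det L$. (3) If $Z\neq0$, then with probability one the algorithm does not fail (no division by zero, no missing pivot, every vector sampled from is a probability vector) and returns a dependency tree of $G$; each dependency tree $t$ is returned with probability $$p(t)=\frac1{\det L}\prod_{(i\to j)\in t}w_{ij}.$$ (4) For an edge $i\to j$ of $G$ with $j\ne 0$, let $G'$ be $G$ with all other incoming edges of $j$ removed. The dependency trees of $G'$ are those of $G$ that contain $i\to j$; the Laplacian $L'$ of $G'$ is $L$ with column $j$ replaced by the vector $c$ above; and if $G'$ has a dependency tree of non-zero weight, then, with $B=L^{-\top}$ and $u=c-L_{[:,j]}$, one has $1+u^\top B_{[:,j]}\ne0$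 and $L'^{-\top}=B-\dfrac{B_{[:,j]}\,u^\top B}{1+u^\top B_{[:,j]}}$. -/

import Mathlib

namespace DepSampling

/-! ## Graphs, trees, Laplacian -/

/-- A rooted directed weighted graph with `N + 1` nodes `0, 1, …, N`, whose root is the node `0`,
with non-negative edge weights that vanish off the edge set. -/
structure Graph (N : ℕ) where
  edges : Finset (Fin (N + 1) × Fin (N + 1))
  w : Fin (N + 1) → Fin (N + 1) → ℝ
  w_nonneg : ∀ i j, 0 ≤ w i j
  w_eq_zero : ∀ i j, (i, j) ∉ edges → w i j = 0

namespace Graph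

variable {N : ℕ}

/-- A directed spanning tree: a set of edges of the graph such that every non-root node has exactly
one incoming edge and there is no directed cycle. -/
def IsSpanningTree (G : Graph N) (t : Finset (Fin (N + 1) × Fin (N + 1))) : Prop :=
  t ⊆ G.edges ∧ (∀ j, j ≠ 0 → ∃! i, (i, j) ∈ t) ∧
    ∀ v, ¬ Relation.TransGen (fun a b => (a, b) ∈ t) v v

/-- A dependency tree: a spanning tree with exactly one edge emanating from the root. -/
def IsDependencyTree (G : Graph N) (t : Finset (Fin (N + 1) × Fin (N + 1))) : Prop :=
  G.IsSpanningTree t ∧ ∃! j, (0, j) ∈ t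

/-- The weight of a tree: the product of its edge weights. -/
def weight (G : Graph N) (t : Finset (Fin (N + 1) × Fin (N + 1))) : ℝ :=
  ∏ e ∈ t, G.w e.1 e.2

open Classical in
/-- The finite set of all dependency trees of the graph. -/
noncomputable def depTrees (G : Graph N) : Finset (Finset (Fin (N + 1) × Fin (N + 1))) :=
  G.edges.powerset.filter G.IsDependencyTree

/-- The normalization constant of the distribution over dependency trees. -/
noncomputable def partition (G : Graph N) : ℝ :=
  ∑ t ∈ G.depTrees, G.weight t

/-- The root-constrained Laplacian. The index `k : Fin N` stands for the non-root node `k.succ`,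
so the first row has index `0`; it holds the root weights. -/
def laplacian (G : Graph N) : Matrix (Fin N) (Fin N) ℝ := fun i j =>
  if i.val = 0 then G.w 0 j.succ
  else if i = j then ∑ k ∈ Finset.univ.filter (fun k : Fin N => k ≠ i), G.w k.succ j.succ
  else - G.w i.succ j.succ

/-- Conditioning on the edge `i → j`: all other incoming edges of `j` are removed. -/
def condition (G : Graph N) (i j : Fin (N + 1)) : Graph N where
  edges := G.edges.filter (fun e => e.2 = j → e.1 = i)
  w := fun a b => if b = j → a = i then G.w a b else 0
  w_nonneg := by
    intro a b
    split_ifs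
    · exact G.w_nonneg a b
    · exact le_rfl
  w_eq_zero := by
    intro a b h
    split_ifs with hab
    · exact G.w_eq_zero a b (fun hm => h (Finset.mem_filter.mpr ⟨hm, hab⟩))
    · rfl

/-- The column that replaces the column of the node `j.succ` in the Laplacian when one conditions on
the edge `i → j.succ`: it is `w • e₁` if `i` is the root, and otherwise
`w • ([j.succ ≠ 1] e_{j.succ} - [i ≠ 1] e_i)`, where `w` is the weight of the edge. -/
def edgeColumn (G : Graph N) (i : Fin (N + 1)) (j : Fin N) : Fin N → ℝ := fun k =>
  if i = 0 then (if k.val = 0 then G.w 0 j.succ else 0)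
  else G.w i j.succ *
    ((if j.val ≠ 0 ∧ k = j then 1 else 0) - (if i.val ≠ 1 ∧ k.succ = i then 1 else 0))

end Graph

/-! ## A randomized real-number RAM with unit-cost operations

Programs are terms of a small imperative language. They can inspect the data only through the
constructors below, and the interpreter charges every operation. There is no arithmetic on
integer registers other than counting in bounded loops. -/

/-- Integer registers; `n` holds the input size. -/
inductive IVar
  | n | i | j | k | c | p | e
  deriving DecidableEq

/-- Real registers. -/
inductive RVar
  | x | y
  deriving DecidableEq

/-- Two-dimensional arrays of real numbers; `W` holds the input. A vector is stored in row `0`. -/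
inductive Arr
  | W | L | B | A | C | M | U | V | Q
  deriving DecidableEq

/-- Index operands: an integer register or a constant. -/
inductive Ref
  | var (v : IVar)
  | lit (a : ℕ)

/-- Real expressions; division is a command, since it can fail. -/
inductive Expr
  | lit (a : ℤ)
  | reg (v : RVar)
  | get (a : Arr) (i j : Ref)
  | add (e f : Expr)
  | sub (e f : Expr)
  | mul (e f : Expr)

/-- Tests. -/
inductive Test
  | eq (a b : Ref)
  | isZero (e : Expr)

/-- Commands. -/
inductive Cmd
  | skip
  | fail
  | seq (c d : Cmd)
  | setI (v : IVar) (r : Ref)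
  | setR (v : RVar) (e : Expr)
  | div (v : RVar) (e f : Expr)
  | put (a : Arr) (i j : Ref) (e : Expr)
  | emit (i j : Ref)
  | ite (b : Test) (c d : Cmd)
  | loop (v : IVar) (lo hi : Ref) (c : Cmd)
  | sample (v : IVar) (a : Arr) (hi : Ref)

/-- Machine states; `out` is the list of the edges `(i, j)` output so far. -/
structure State where
  ints : IVar → ℕ
  reals : RVar → ℝ
  mem : Arr → ℕ → ℕ → ℝ
  out : List (ℕ × ℕ)

namespace State

def setI (s : State) (v : IVar) (a : ℕ) : State :=
  { s with ints := Function.update s.ints v a }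

def setR (s : State) (v : RVar) (a : ℝ) : State :=
  { s with reals := Function.update s.reals v a }

def put (s : State) (a : Arr) (i j : ℕ) (v : ℝ) : State :=
  { s with
    mem := Function.update s.mem a
      (Function.update (s.mem a) i (Function.update (s.mem a i) j v)) }

def emit (s : State) (i j : ℕ) : State :=
  { s with out := s.out ++ [(i, j)] }

end State

def Ref.eval (s : State) : Ref → ℕ
  | .var v => s.ints v
  | .lit a => a

def Expr.eval (s : State) : Expr → ℝ
  | .lit a => (a : ℝ)
  | .reg v => s.reals v
  | .get a i j => s.mem a (i.eval s) (j.eval s)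
  | .add e f => e.eval s + f.eval s
  | .sub e f => e.eval s - f.eval s
  | .mul e f => e.eval s * f.eval s

/-- Every constant, register access, array access and arithmetic operation costs one step. -/
def Expr.cost : Expr → ℕ
  | .lit _ => 1
  | .reg _ => 1
  | .get _ _ _ => 1
  | .add e f => e.cost + f.cost + 1
  | .sub e f => e.cost + f.cost + 1
  | .mul e f => e.cost + f.cost + 1

def Test.holds (s : State) : Test → Prop
  | .eq a b => a.eval s = b.eval s
  | .isZero e => e.eval s = 0

def Test.cost : Test → ℕ
  | .eq _ _ => 1
  | .isZero e => e.cost + 1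

/-- The result of a randomized run: the final state, or `none` if the run failed, together with the
number of steps. -/
abbrev Run := PMF (Option State × ℕ)

namespace Run

noncomputable def ret (s : State) : Run := PMF.pure (some s, 0)

noncomputable def abort : Run := PMF.pure (none, 0)

/-- Add `a` steps. -/
noncomputable def tick (a : ℕ) (r : Run) : Run := PMF.map (fun q => (q.1, q.2 + a)) r

/-- Continue every run that has not failed; the steps add up. -/
noncomputable def andThen (r : Run) (f : State → Run) : Run :=
  PMF.bind r fun q => match q.1 with
    | none => PMF.pure (none, q.2)
    | some s => (f s).tick q.2

/-- Run the body once for every value in the list, with the loop register set to that value;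
each iteration has an overhead of one step. -/
noncomputable def iterate (z : IVar) (body : State → Run) : List ℕ → State → Run
  | [], s => ret s
  | v :: vs, s => ((body (s.setI z v)).tick 1).andThen (iterate z body vs)

end Run

/-- `m 0, …, m h` is a probability vector. -/
def IsProbVec (m : ℕ → ℝ) (h : ℕ) : Prop :=
  (∀ k ∈ Finset.range (h + 1), 0 ≤ m k) ∧ ∑ k ∈ Finset.range (h + 1), m k = 1

/-- The distribution on `0, …, h` with the probabilities `m 0, …, m h`. -/
noncomputable def probVec (m : ℕ → ℝ) (h : ℕ) (hm : IsProbVec m h) : PMF ℕ :=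
  PMF.ofFinset (fun k => if k ∈ Finset.range (h + 1) then ENNReal.ofReal (m k) else 0)
    (Finset.range (h + 1))
    (by
      rw [Finset.sum_congr rfl (fun k hk => if_pos hk), ← ENNReal.ofReal_sum_of_nonneg hm.1, hm.2,
        ENNReal.ofReal_one])
    (fun _ hk => if_neg hk)

open Classical in
/-- The interpreter. `div` fails if the divisor is zero. `loop` runs through the values from `lo` to
`hi` inclusive. `sample` draws an index from the distribution stored in the entries `0, …, hi` of a
vector, fails if these entries are not a probability vector, and costs one step per entry. -/
noncomputable def Cmd.exec : Cmd → State → Run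
  | .skip, s => Run.ret s
  | .fail, _ => Run.abort.tick 1
  | .seq c d, s => (c.exec s).andThen d.exec
  | .setI v r, s => (Run.ret (s.setI v (r.eval s))).tick 1
  | .setR v e, s => (Run.ret (s.setR v (e.eval s))).tick (e.cost + 1)
  | .div v e f, s =>
      Run.tick (e.cost + f.cost + 1)
        (if f.eval s = 0 then Run.abort else Run.ret (s.setR v (e.eval s / f.eval s)))
  | .put a i j e, s => (Run.ret (s.put a (i.eval s) (j.eval s) (e.eval s))).tick (e.cost + 1)
  | .emit i j, s => (Run.ret (s.emit (i.eval s) (j.eval s))).tick 1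
  | .ite b c d, s => Run.tick b.cost (if b.holds s then c.exec s else d.exec s)
  | .loop v lo hi c, s =>
      (Run.iterate v c.exec (List.range' (lo.eval s) (hi.eval s + 1 - lo.eval s)) s).tick 1
  | .sample v a hi, s =>
      Run.tick (hi.eval s + 2)
        (if hm : IsProbVec (s.mem a 0) (hi.eval s) then
          PMF.map (fun b => (some (s.setI v b), 0)) (probVec (s.mem a 0) (hi.eval s) hm)
        else Run.abort)

/-! ## The sampling algorithm -/

namespace Prog

local infixr:60 " ;; " => Cmd.seq

abbrev n : Ref := .var .n
abbrev i : Ref := .var .i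
abbrev j : Ref := .var .j
abbrev k : Ref := .var .k
abbrev c : Ref := .var .c
abbrev p : Ref := .var .p
abbrev e : Ref := .var .e
abbrev zero : Ref := .lit 0
abbrev one : Ref := .lit 1
abbrev x : Expr := .reg .x
abbrev y : Expr := .reg .y

/-- Run the body with the register `v` going through `1, …, N`. -/
abbrev each (v : IVar) (body : Cmd) : Cmd := .loop v one n body

/-- Assignment to and access to an entry of a vector. -/
abbrev putV (a : Arr) (r : Ref) (f : Expr) : Cmd := .put a zero r f
abbrev getV (a : Arr) (r : Ref) : Expr := .get a zero r

/-- Construct the root-constrained Laplacian in `L`, which is zero initially. -/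
def laplacian : Cmd :=
  each .j (
    each .i (
      .ite (.eq i j) .skip (
        .put .L i j (.sub (.lit 0) (.get .W i j)) ;;
        .put .L j j (.add (.get .L j j) (.get .W i j)))) ;;
    .put .L one j (.get .W zero j))

/-- Swap the rows `k` and `p` of an array. -/
def swapRows (a : Arr) : Cmd :=
  each .c (
    .setR .x (.get a k c) ;;
    .put a k c (.get a p c) ;;
    .put a p c x)

/-- Divide the row `k` of an array by the real register `x`. -/
def scaleRow (a : Arr) : Cmd :=
  each .c (.div .y (.get a k c) x ;; .put a k c y)

/-- Subtract `x` times the row `k` from the row `i` of an array. -/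
def subRow (a : Arr) : Cmd :=
  each .c (.put a i c (.sub (.get a i c) (.mul x (.get a k c))))

/-- Store the transposed inverse of `L` in `B`: Gauss–Jordan elimination with pivot search on a
copy `A` of `L`, with the row operations mirrored on an identity matrix `C`. -/
def inverseTranspose : Cmd :=
  each .i (each .c (.put .A i c (.get .L i c) ;; .put .C i c (.lit 0)) ;; .put .C i i (.lit 1)) ;;
  each .k (
    .setI .p zero ;;
    .loop .i k n (.ite (.isZero (.get .A i k)) .skip (.setI .p i)) ;;
    .ite (.eq p zero) .fail .skip ;;
    swapRows .A ;;
    swapRows .C ;;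
    .setR .x (.get .A k k) ;;
    scaleRow .A ;;
    scaleRow .C ;;
    each .i (
      .ite (.eq i k) .skip (
        .setR .x (.get .A i k) ;;
        subRow .A ;;
        subRow .C))) ;;
  each .i (each .c (.put .B i c (.get .C c i)))

/-- Sample an incoming edge `e → j` of the node `j` from the edge marginals given by `B`. -/
def sampleEdge : Cmd :=
  putV .M zero (.mul (.get .W zero j) (.get .B one j)) ;;
  each .i (
    .ite (.eq i j) (putV .M i (.lit 0)) (
      .setR .x (.lit 0) ;;
      .ite (.eq j one) .skip (.setR .x (.get .B j j)) ;;
      .ite (.eq i one) .skip (.setR .x (.sub x (.get .B i j))) ;;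
      putV .M i (.mul (.get .W i j) x))) ;;
  .sample .e .M n

/-- Condition on the edge `e → j`: with `u` the new minus the old column `j` of the Laplacian,
add `u` to the column `j` of `L`, and subtract
`B[:, j] (uᵀ B) / (1 + uᵀ B[:, j])` from `B` (Sherman–Morrison). -/
def condition : Cmd :=
  each .i (putV .U i (.sub (.lit 0) (.get .L i j))) ;;
  .ite (.eq e zero)
    (putV .U one (.add (getV .U one) (.get .W zero j)))
    (.ite (.eq j one) .skip (putV .U j (.add (getV .U j) (.get .W e j))) ;;
      .ite (.eq e one) .skip (putV .U e (.sub (getV .U e) (.get .W e j)))) ;;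
  each .i (.put .L i j (.add (.get .L i j) (getV .U i))) ;;
  each .k (
    putV .V k (.lit 0) ;;
    each .i (putV .V k (.add (getV .V k) (.mul (getV .U i) (.get .B i k))))) ;;
  .setR .x (.lit 1) ;;
  each .i (.setR .x (.add x (.mul (getV .U i) (.get .B i j)))) ;;
  each .i (.div .y (.get .B i j) x ;; putV .Q i y) ;;
  each .i (each .k (.put .B i k (.sub (.get .B i k) (.mul (getV .Q i) (getV .V k)))))

/-- The ancestral sampler. -/
def colbourn : Cmd :=
  laplacian ;;
  inverseTranspose ;;
  each .j (
    sampleEdge ;;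
    .emit e j ;;
    condition)

end Prog

/-- The initial state: the size `N` is in the register `n`, the weights of the graph are in `W`, and
everything else is zero. -/
def initState {N : ℕ} (G : Graph N) : State where
  ints := fun v => if v = .n then N else 0
  reals := fun _ => 0
  mem := fun a i j =>
    if a = .W then
      (if h : i < N + 1 ∧ j < N + 1 then G.w ⟨i, h.1⟩ ⟨j, h.2⟩ else 0)
    else 0
  out := []

/-- The run of the ancestral sampler on a graph. -/
noncomputable def colbournRun {N : ℕ} (G : Graph N) : Run :=
  Prog.colbourn.exec (initState G)

/-- The distribution of the set of edges returned by the ancestral sampler (`none` for failure). -/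
noncomputable def colbournOutput {N : ℕ} (G : Graph N) : PMF (Option (Finset (ℕ × ℕ))) :=
  PMF.map (fun q => q.1.map (fun s => s.out.toFinset)) (colbournRun G)

/-- A set of edges, with the nodes written as natural numbers. -/
def edgeCode {N : ℕ} (t : Finset (Fin (N + 1) × Fin (N + 1))) : Finset (ℕ × ℕ) :=
  t.image (fun e => (e.1.val, e.2.val))

end DepSampling

/-! Matrix-tree part. A dependency tree is the same as a parent function `f` on the non-root nodes,
acyclic and with exactly one child of the root (`isDependencyTree_iff`). Column `j` of the Laplacian
is the sum over `i` of `w i j` times the column of a single edge (`sum_edgeColumn`), so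
multilinearity expands `det L` into a sum over all parent functions of their weight times a
determinant with entries in {-1, 0, 1} (`det_laplacian_eq_sum`). That determinant is 1 for a tree
and 0 otherwise: the rows of the nodes on cycles sum to zero, two children of the root give equal
rows, and an acyclic `f` without a child of the root cannot exist.

Conditioning part. By Cramer's rule, column `j` of `B` paired with an edge column is `det L' / det
L`, that is, `Z' / Z` (`marginal_eq`). So the numbers `m_i` are the exact marginals, they sum to 1,
and the Sherman–Morrison denominator is again `det L' / det L`, hence non-zero as soon as `Z'` is.

Running time. A bound computed from the syntax of the program holds for every run, because all loops
end at the register `n`, which is never written (`Cmd.within_bound`).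

Correctness of the sampler. Only lower bounds are proved for the program. Fix a tree of positive
weight with parent function `f` and follow the one execution path that draws `f j` for each `j`. Let
`Z m` be the partition function after the first `m` nodes are fixed (`restrict`). Step `m` of the
path has probability `Z m / Z (m - 1)`, the product telescopes, and the tree is returned with
probability at least `w(t) / Z` (`colbourn_spec`, `le_colbournOutput`). These bounds sum to 1, so
they are attained and no mass is left for failure or any other output (`PMF_eq_of_le`). Thus no path
outside the trees of positive weight has to be analysed. -/

namespace DepSampling

namespace Graph

open Relation Finset

variable {N : ℕ}

/-! ## Trees as parent functions -/

/-- The edge set of a parent function. -/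
def parentEdges (f : Fin N → Fin (N + 1)) : Finset (Fin (N + 1) × Fin (N + 1)) :=
  univ.image fun j => (f j, j.succ)

theorem mem_parentEdges {f : Fin N → Fin (N + 1)} {a b : Fin (N + 1)} :
    (a, b) ∈ parentEdges f ↔ ∃ j, f j = a ∧ j.succ = b := by
  simp [parentEdges]

theorem mem_parentEdges_succ {f : Fin N → Fin (N + 1)} {a : Fin (N + 1)} {j : Fin N} :
    (a, j.succ) ∈ parentEdges f ↔ a = f j := by
  simp [mem_parentEdges, eq_comm]

theorem parentEdges_injective : Function.Injective (parentEdges (N := N)) := by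
  intro f g h
  funext j
  have : (f j, j.succ) ∈ parentEdges g := h ▸ mem_parentEdges_succ.2 rfl
  exact mem_parentEdges_succ.1 this

/-- Parent functions of trees with a unique child of the root. -/
def IsTreeFun (f : Fin N → Fin (N + 1)) : Prop :=
  (∀ v, ¬ TransGen (fun a b => (a, b) ∈ parentEdges f) v v) ∧ ∃! j, f j = 0

theorem weight_parentEdges (G : Graph N) (f : Fin N → Fin (N + 1)) :
    G.weight (parentEdges f) = ∏ j, G.w (f j) j.succ := by
  rw [weight, parentEdges, prod_image]
  intro a _ b _ h
  simpa using congrArg Prod.snd h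

theorem existsUnique_root_edge {f : Fin N → Fin (N + 1)} :
    (∃! j, ((0 : Fin (N + 1)), j) ∈ parentEdges f) ↔ ∃! j, f j = 0 := by
  constructor
  · rintro ⟨b, hb, hu⟩
    obtain ⟨j, hj, rfl⟩ := mem_parentEdges.1 hb
    exact ⟨j, hj, fun k hk => Fin.succ_injective _ (hu _ (mem_parentEdges_succ.2 hk.symm))⟩
  · rintro ⟨j, hj, hu⟩
    refine ⟨j.succ, mem_parentEdges_succ.2 hj.symm, fun b hb => ?_⟩
    obtain ⟨k, hk, rfl⟩ := mem_parentEdges.1 hb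
    rw [hu k hk]

theorem wellFounded_of_acyclic {t : Finset (Fin (N + 1) × Fin (N + 1))}
    (h : ∀ v, ¬ TransGen (fun a b => (a, b) ∈ t) v v) :
    WellFounded (TransGen fun a b => (a, b) ∈ t) := by
  have : Std.Irrefl (TransGen fun a b => (a, b) ∈ t) := ⟨h⟩
  exact Finite.wellFounded_of_trans_of_irrefl _

/-- Induction along ancestors shows that every node is reachable from the root, so an edge into the
root would close a cycle. Hence all edges enter non-root nodes and are given by the parent function.
-/
theorem isDependencyTree_iff (G : Graph N) (t : Finset (Fin (N + 1) × Fin (N + 1))) :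
    G.IsDependencyTree t ↔ ∃ f, t = parentEdges f ∧ parentEdges f ⊆ G.edges ∧ IsTreeFun f := by
  constructor
  · rintro ⟨⟨hs, hp, hc⟩, hr⟩
    choose f hf hu using fun j : Fin N => hp j.succ (Fin.succ_ne_zero j)
    have hroot : ∀ v, ReflTransGen (fun a b => (a, b) ∈ t) 0 v := by
      intro v
      induction v using (wellFounded_of_acyclic hc).induction with
      | _ v ih =>
        induction v using Fin.cases with
        | zero => exact .refl
        | succ j => exact (ih _ (.single (hf j))).tail (hf j)
    have ht : t = parentEdges f := by
      ext ⟨a, b⟩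
      induction b using Fin.cases with
      | zero =>
        refine ⟨fun h => (hc _ (TransGen.tail' (hroot a) h)).elim, fun h => ?_⟩
        obtain ⟨j, -, hj⟩ := mem_parentEdges.1 h
        exact (Fin.succ_ne_zero j hj).elim
      | succ j =>
        rw [mem_parentEdges_succ]
        exact ⟨fun h => hu j a h, fun h => h ▸ hf j⟩
    subst ht
    exact ⟨f, rfl, hs, hc, existsUnique_root_edge.1 hr⟩
  · rintro ⟨f, rfl, hs, hc, hr⟩
    refine ⟨⟨hs, fun j hj => ?_, hc⟩, existsUnique_root_edge.2 hr⟩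
    obtain ⟨k, rfl⟩ := Fin.exists_succ_eq.2 hj
    exact ⟨f k, mem_parentEdges_succ.2 rfl, fun a ha => mem_parentEdges_succ.1 ha⟩

theorem mem_depTrees {G : Graph N} {t : Finset (Fin (N + 1) × Fin (N + 1))} :
    t ∈ G.depTrees ↔ G.IsDependencyTree t := by
  simp only [depTrees, mem_filter, mem_powerset, and_iff_right_iff_imp]
  exact fun h => h.1.1

theorem weight_nonneg (G : Graph N) (t : Finset (Fin (N + 1) × Fin (N + 1))) : 0 ≤ G.weight t :=
  prod_nonneg fun _ _ => G.w_nonneg _ _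

theorem partition_nonneg (G : Graph N) : 0 ≤ G.partition :=
  sum_nonneg fun _ _ => G.weight_nonneg _

-- Membership in the edge set can be dropped from the sum, since an edge outside it has weight zero
-- and kills the product.
open Classical in
theorem partition_eq_sum_treeFun (G : Graph N) :
    G.partition = ∑ f : Fin N → Fin (N + 1), if IsTreeFun f then ∏ j, G.w (f j) j.succ else 0 := by
  have h : G.depTrees =
      (univ.filter fun f => parentEdges f ⊆ G.edges ∧ IsTreeFun f).image parentEdges := by
    ext t
    rw [mem_depTrees, isDependencyTree_iff]
    simp only [mem_image, mem_filter, mem_univ, true_and]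
    exact ⟨fun ⟨f, h, h'⟩ => ⟨f, h', h.symm⟩, fun ⟨f, h, h'⟩ => ⟨f, h'.symm, h⟩⟩
  rw [partition, h, sum_image parentEdges_injective.injOn, sum_filter]
  refine sum_congr rfl fun f _ => ?_
  rw [weight_parentEdges]
  by_cases hf : IsTreeFun f
  · by_cases he : parentEdges f ⊆ G.edges
    · simp [hf, he]
    · obtain ⟨⟨a, b⟩, hab, hn⟩ := not_subset.1 he
      obtain ⟨j, rfl, rfl⟩ := mem_parentEdges.1 hab
      rw [if_neg (fun h => he h.1), if_pos hf]
      exact (prod_eq_zero (mem_univ j) (G.w_eq_zero _ _ hn)).symm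
  · simp [hf]

/-! ## The matrix-tree theorem for the root-constrained Laplacian -/

/-- The column of the root-constrained Laplacian of a single edge of weight one. -/
def edgeVector (i : Fin (N + 1)) (j : Fin N) : Fin N → ℝ := fun k =>
  if i = 0 then (if k.val = 0 then 1 else 0)
  else (if j.val ≠ 0 ∧ k = j then 1 else 0) - (if i.val ≠ 1 ∧ k.succ = i then 1 else 0)

theorem edgeColumn_eq_smul (G : Graph N) (i : Fin (N + 1)) (j : Fin N) :
    G.edgeColumn i j = G.w i j.succ • edgeVector i j := by
  funext k
  by_cases hi : i = 0
  · subst hi; simp [edgeColumn, edgeVector]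
  · simp [edgeColumn, edgeVector, hi]

/-- The two guards on node 1 amount to one rule: a non-root edge has entry zero in the first row,
which is reserved for the root weights. -/
theorem edgeVector_succ (i j k : Fin N) :
    edgeVector i.succ j k =
      if k.val = 0 then 0 else (if k = j then 1 else 0) - (if k = i then 1 else 0) := by
  simp only [edgeVector, Fin.succ_ne_zero, if_false, Fin.val_succ, Fin.succ_inj]
  by_cases hk : k.val = 0
  · have h1 : ¬ (j.val ≠ 0 ∧ k = j) := fun h => h.1 (h.2 ▸ hk)
    have h2 : ¬ (i.val + 1 ≠ 1 ∧ k = i) := fun h => h.1 (by rw [← h.2, hk])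
    simp only [h1, h2, hk, if_true, if_false, sub_zero]
  · have h1 : (j.val ≠ 0 ∧ k = j) ↔ k = j := ⟨fun h => h.2, fun h => ⟨h ▸ hk, h⟩⟩
    have h2 : (i.val + 1 ≠ 1 ∧ k = i) ↔ k = i :=
      ⟨fun h => h.2, fun h => ⟨by rw [← h]; omega, h⟩⟩
    simp only [h1, h2, hk, if_false]

/-- The edge vector of a self-loop vanishes, which matches the omission of `k = i` on the diagonal
of the Laplacian. -/
theorem sum_edgeColumn (G : Graph N) (j k : Fin N) :
    ∑ i, G.edgeColumn i j k = G.laplacian k j := by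
  simp only [edgeColumn_eq_smul, Pi.smul_apply, smul_eq_mul]
  rw [Fin.sum_univ_succ]
  simp only [edgeVector_succ, laplacian]
  by_cases hk : k.val = 0
  · simp [edgeVector, hk]
  · simp only [edgeVector, hk, if_true, if_false, mul_zero, zero_add]
    by_cases hkj : k = j
    · subst hkj
      simp only [if_true, sum_filter]
      refine sum_congr rfl fun i _ => ?_
      by_cases h : i = k
      · simp [h]
      · simp [h, Ne.symm h]
    · simp [hkj]

/-- Multilinearity of the determinant in the columns: choosing one summand per column is choosing a
parent for each node. -/
theorem det_laplacian_eq_sum (G : Graph N) :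
    G.laplacian.det = ∑ f : Fin N → Fin (N + 1),
      (∏ j, G.w (f j) j.succ) * (Matrix.of fun j => edgeVector (f j) j).det := by
  have h : G.laplacian.transpose = fun j => ∑ i, G.w i j.succ • edgeVector i j := by
    ext j k
    rw [Matrix.transpose_apply, ← sum_edgeColumn, Finset.sum_apply]
    simp [edgeColumn_eq_smul]
  rw [← Matrix.det_transpose, h]
  have := (Matrix.detRowAlternating (n := Fin N) (R := ℝ)).toMultilinearMap.map_sum
    (fun (j : Fin N) (i : Fin (N + 1)) => G.w i j.succ • edgeVector i j)
  refine this.trans (sum_congr rfl fun f _ => ?_)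
  exact (Matrix.detRowAlternating (n := Fin N) (R := ℝ)).toMultilinearMap.map_smul_univ
    (fun j => G.w (f j) j.succ) (fun j => edgeVector (f j) j)

/-- The parent map permutes the set `S` of nodes on cycles, so the rows `e_j - e_{f j}` with `j ∈ S`
sum to zero, and the indicator of `S` is a non-zero left kernel vector. -/
theorem det_edgeVector_eq_zero_of_cycle {f : Fin N → Fin (N + 1)}
    (h : ¬ ∀ v, ¬ TransGen (fun a b => (a, b) ∈ parentEdges f) v v) :
    (Matrix.of fun j => edgeVector (f j) j).det = 0 := by
  classical
  push Not at h
  obtain ⟨v, hv⟩ := h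
  set R := TransGen fun a b => (a, b) ∈ parentEdges f with hR
  -- the parent of a node on a cycle is on a cycle
  have hpar : ∀ j : Fin N, R j.succ j.succ → R (f j) (f j) := by
    intro j hj
    obtain ⟨c, h1, h2⟩ := TransGen.tail'_iff.1 hj
    obtain rfl := mem_parentEdges_succ.1 h2
    exact TransGen.head' (mem_parentEdges_succ.2 rfl) h1
  have hne : ∀ a : Fin (N + 1), R a a → a ≠ 0 := by
    rintro a ha rfl
    obtain ⟨c, -, h2⟩ := TransGen.tail'_iff.1 ha
    obtain ⟨j, -, hj⟩ := mem_parentEdges.1 h2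
    exact Fin.succ_ne_zero j hj
  have hg : ∀ j : Fin N, ∃ i : Fin N, R j.succ j.succ → f j = i.succ := by
    intro j
    by_cases hj : R j.succ j.succ
    · obtain ⟨i, hi⟩ := Fin.exists_succ_eq.2 (hne _ (hpar j hj))
      exact ⟨i, fun _ => hi.symm⟩
    · exact ⟨j, fun h => (hj h).elim⟩
  choose g hg using hg
  set S : Finset (Fin N) := univ.filter fun j => R j.succ j.succ with hS
  have hmem : ∀ j, j ∈ S ↔ R j.succ j.succ := fun j => by simp [hS]
  have hmaps : ∀ j ∈ S, g j ∈ S := by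
    intro j hj
    rw [hmem] at hj ⊢
    rw [← hg j hj]
    exact hpar j hj
  -- The successor of a node along its cycle is on a cycle too and has that node as parent.
  -- Injectivity then follows by counting.
  have hsurj : Set.SurjOn g S S := by
    intro i hi
    have hi' := (hmem i).1 hi
    obtain ⟨c, h1, h2⟩ := TransGen.head'_iff.1 hi'
    obtain ⟨j, hj, rfl⟩ := mem_parentEdges.1 h1
    have hjS : R j.succ j.succ := TransGen.tail' h2 h1
    exact ⟨j, (hmem j).2 hjS, Fin.succ_injective _ (by rw [← hg j hjS, hj])⟩
  have hinj : Set.InjOn g S := Finset.injOn_of_surjOn_of_card_le g hmaps hsurj le_rfl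
  rw [← Matrix.exists_vecMul_eq_zero_iff]
  refine ⟨fun j => if j ∈ S then 1 else 0, fun h0 => ?_, ?_⟩
  · obtain ⟨j, rfl⟩ := Fin.exists_succ_eq.2 (hne v hv)
    have := congrFun h0 j
    simp [(hmem j).2 hv] at this
  · funext k
    simp only [Matrix.vecMul, dotProduct, Matrix.of_apply, ite_mul, one_mul, zero_mul,
      Pi.zero_apply]
    rw [← sum_filter, filter_mem_eq_inter, univ_inter]
    have : ∀ j ∈ S, edgeVector (f j) j k =
        if k.val = 0 then 0 else (if k = j then 1 else 0) - (if k = g j then 1 else 0) := by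
      intro j hj
      rw [hg j ((hmem j).1 hj), edgeVector_succ]
    rw [sum_congr rfl this]
    by_cases hk : k.val = 0
    · simp [hk]
    · simp only [hk, if_false, sum_sub_distrib]
      rw [sub_eq_zero]
      exact (sum_nbij (s := S) (t := S) (f := fun j => if k = g j then (1 : ℝ) else 0)
        (g := fun i => if k = i then (1 : ℝ) else 0) g hmaps hinj hsurj (fun _ _ => rfl)).symm

/-- The incidence matrix of a parent function; the row of `j` is `e_j - e_{f j}`, with `e_0 = 0`. -/
def incidence (f : Fin N → Fin (N + 1)) : Matrix (Fin N) (Fin N) ℝ :=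
  Matrix.of fun j k => (if k = j then 1 else 0) - (if k.succ = f j then 1 else 0)

/-- Passing to the parent strictly lowers the number `d` of proper ancestors, so the matrix is block
triangular for `d`; nodes with the same `d` are never parent and child, so the diagonal blocks are
identities. -/
theorem det_incidence {f : Fin N → Fin (N + 1)}
    (h : ∀ v, ¬ TransGen (fun a b => (a, b) ∈ parentEdges f) v v) :
    (incidence f).det = 1 := by
  classical
  set R := TransGen fun a b => (a, b) ∈ parentEdges f with hR
  let d : Fin N → ℕ := fun j => #(univ.filter fun v => R v j.succ)
  have hd : ∀ j k : Fin N, k.succ = f j → d k < d j := by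
    intro j k hk
    have hkj : R k.succ j.succ := .single (mem_parentEdges_succ.2 hk)
    refine card_lt_card (ssubset_iff_of_subset ?_ |>.2 ⟨k.succ, by simpa using hkj, by
      simpa using h k.succ⟩)
    intro v hv
    simp only [mem_filter, mem_univ, true_and] at hv ⊢
    exact hv.trans hkj
  have ht : (incidence f).BlockTriangular (OrderDual.toDual ∘ d) := by
    intro j k hjk
    have h1 : ¬ k = j := by rintro rfl; exact lt_irrefl _ hjk
    have h2 : ¬ k.succ = f j := fun hk => absurd (hd j k hk) (not_lt.2 (le_of_lt hjk))
    simp [incidence, h1, h2]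
  rw [ht.det]
  refine prod_eq_one fun a _ => ?_
  have : (incidence f).toSquareBlock (OrderDual.toDual ∘ d) a = 1 := by
    ext ⟨j, hj⟩ ⟨k, hk⟩
    have h2 : ¬ k.succ = f j := fun h => by
      have := hd j k h
      have e : OrderDual.toDual (d j) = OrderDual.toDual (d k) := hj.trans hk.symm
      rw [OrderDual.toDual_inj] at e
      omega
    simp [incidence, Matrix.toSquareBlock_def, Matrix.one_apply, h2, eq_comm (a := j)]
  rw [this, Matrix.det_one]

/-- Replacing row `r` by `e_c` and replacing column `c` by `e_r` both compute the same entry of the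
adjugate. -/
theorem det_updateRow_updateCol_single {n : Type*} [Fintype n] [DecidableEq n]
    (A : Matrix n n ℝ) (r c : n) :
    ((A.updateCol c (Pi.single r 1)).updateRow r (Pi.single c 1)).det =
      (A.updateCol c (Pi.single r 1)).det := by
  have key : ∀ X : Matrix n n ℝ, (X.updateRow r (Pi.single c 1)).det =
      (X.updateCol c (Pi.single r 1)).det := by
    intro X
    rw [← Matrix.adjugate_apply, ← Matrix.det_transpose (X.updateCol _ _),
      ← Matrix.updateRow_transpose, ← Matrix.adjugate_apply, ← Matrix.adjugate_transpose,
      Matrix.transpose_apply]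
  rw [key, Matrix.updateCol_idem]

/-- The columns of the incidence matrix sum to `e_r`, with `r` the child of the root, so putting
this sum into the first column keeps the determinant 1. Since that column is now `e_r`, row `r` may
be replaced by `e_z`, with `z` the first index, and the result is the matrix of edge vectors. -/
theorem det_edgeVector_eq_one {f : Fin N → Fin (N + 1)} (h : IsTreeFun f) :
    (Matrix.of fun j => edgeVector (f j) j).det = 1 := by
  obtain ⟨hc, r, hr, hu⟩ := h
  have hN : 0 < N := r.pos
  let z : Fin N := ⟨0, hN⟩
  have hz : ∀ k : Fin N, k.val = 0 ↔ k = z := fun k => by simp [z, Fin.ext_iff]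
  -- the sum of the columns of the incidence matrix is the indicator vector of the root child
  have hsum : ∀ j, ∑ k, incidence f j k = (Pi.single r 1 : Fin N → ℝ) j := by
    intro j
    simp only [incidence, Matrix.of_apply, sum_sub_distrib, sum_ite_eq', mem_univ, if_true]
    by_cases hj : f j = 0
    · obtain rfl := hu j hj
      simp [hj, Fin.succ_ne_zero]
    · obtain ⟨i, hi⟩ := Fin.exists_succ_eq.2 hj
      have : j ≠ r := by rintro rfl; exact hj hr
      simp [← hi, this]
  have h1 : ((incidence f).updateCol z (Pi.single r 1)).det = 1 := by
    have h := Matrix.det_updateCol_sum (incidence f) z (fun _ => 1)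
    rw [det_incidence hc, one_smul] at h
    refine Eq.trans ?_ h
    congr 2
    funext j
    simp [← hsum j]
  have h2 : (Matrix.of fun j => edgeVector (f j) j) =
      (((incidence f).updateCol z (Pi.single r 1)).updateRow r (Pi.single z 1)) := by
    ext j k
    by_cases hj : j = r
    · subst hj
      simp [edgeVector, hr, hz, Pi.single_apply]
    · have hfj : f j ≠ 0 := fun h => hj (hu j h)
      obtain ⟨i, hi⟩ := Fin.exists_succ_eq.2 hfj
      rw [Matrix.updateRow_ne hj, Matrix.of_apply, ← hi, edgeVector_succ, Matrix.updateCol_apply]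
      simp [hz, incidence, ← hi, hj]
  rw [h2, det_updateRow_updateCol_single, h1]

theorem partition_eq_det (hN : 1 ≤ N) (G : Graph N) : G.partition = G.laplacian.det := by
  classical
  rw [partition_eq_sum_treeFun, det_laplacian_eq_sum]
  refine sum_congr rfl fun f _ => ?_
  split_ifs with hf
  · rw [det_edgeVector_eq_one hf, mul_one]
  · suffices h : (Matrix.of fun j => edgeVector (f j) j).det = 0 by rw [h, mul_zero]
    by_cases hc : ∀ v, ¬ TransGen (fun a b => (a, b) ∈ parentEdges f) v v
    · by_cases h0 : ∃ j, f j = 0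
      · obtain ⟨j, hj⟩ := h0
        have : ∃ k, f k = 0 ∧ k ≠ j := by
          by_contra! hn
          exact hf ⟨hc, j, hj, fun k hk => hn k hk⟩
        obtain ⟨k, hk, hkj⟩ := this
        refine Matrix.det_zero_of_row_eq hkj ?_
        funext l
        simp [hj, hk, edgeVector]
      -- A non-root node that is minimal for ancestry would have a non-root parent. Such a node
      -- exists because `1 ≤ N`; for `N = 0` the theorem fails, the empty determinant being 1 and
      -- there being no dependency tree.
      · exfalso
        push Not at h0
        obtain ⟨_, ⟨l, rfl⟩, hj⟩ := (wellFounded_of_acyclic hc).has_min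
          (Set.range (Fin.succ : Fin N → Fin (N + 1))) ⟨_, ⟨0, hN⟩, rfl⟩
        obtain ⟨i, hi⟩ := Fin.exists_succ_eq.2 (h0 l)
        exact hj _ ⟨i, hi⟩ (.single (mem_parentEdges_succ.2 rfl))
    · exact det_edgeVector_eq_zero_of_cycle hc

/-! ## Conditioning on an edge -/

theorem isDependencyTree_condition_iff (G : Graph N) (i : Fin (N + 1)) (j : Fin N)
    (t : Finset (Fin (N + 1) × Fin (N + 1))) :
    (G.condition i j.succ).IsDependencyTree t ↔ G.IsDependencyTree t ∧ (i, j.succ) ∈ t := by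
  have hsub : t ⊆ (G.condition i j.succ).edges ↔
      t ⊆ G.edges ∧ ∀ a, (a, j.succ) ∈ t → a = i := by
    simp only [condition, subset_iff, mem_filter]
    constructor
    · exact fun h => ⟨fun e he => (h he).1, fun a ha => (h ha).2 rfl⟩
    · rintro ⟨h1, h2⟩ ⟨a, b⟩ he
      exact ⟨h1 he, by rintro rfl; exact h2 a he⟩
  constructor
  · rintro ⟨⟨hs, hp, hc⟩, hr⟩
    obtain ⟨a, ha, -⟩ := hp j.succ (Fin.succ_ne_zero j)
    have hs' := hsub.1 hs
    exact ⟨⟨⟨hs'.1, hp, hc⟩, hr⟩, hs'.2 a ha ▸ ha⟩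
  · rintro ⟨⟨⟨hs, hp, hc⟩, hr⟩, hi⟩
    exact ⟨⟨hsub.2 ⟨hs, fun a ha => (hp j.succ (Fin.succ_ne_zero j)).unique ha hi⟩, hp, hc⟩, hr⟩

theorem laplacian_condition (G : Graph N) (i : Fin (N + 1)) (j : Fin N) :
    (G.condition i j.succ).laplacian = G.laplacian.updateCol j (G.edgeColumn i j) := by
  ext k l
  rw [← sum_edgeColumn, Matrix.updateCol_apply]
  by_cases hl : l = j
  · subst hl
    rw [if_pos rfl, sum_eq_single i]
    · simp [edgeColumn_eq_smul, condition]
    · intro a _ ha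
      simp [edgeColumn_eq_smul, condition, ha]
    · simp
  · rw [if_neg hl, ← sum_edgeColumn]
    simp [edgeColumn_eq_smul, condition, hl]

/-- Cramer's rule. For singular `A` both sides are 0 by the conventions for inverse and division. -/
theorem inv_transpose_dotProduct {n : Type*} [Fintype n] [DecidableEq n] (A : Matrix n n ℝ)
    (c : n → ℝ) (j : n) :
    (fun k => (A⁻¹).transpose k j) ⬝ᵥ c = (A.updateCol j c).det / A.det := by
  rw [← Matrix.cramer_apply, Matrix.cramer_eq_adjugate_mulVec, Matrix.inv_def]
  simp [Matrix.mulVec, dotProduct, mul_sum, div_eq_inv_mul, mul_assoc]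

/-- Identifies the denominator of the rank-one update as a ratio of determinants; the 1 cancels
against the pairing of column `j` of the transposed inverse with column `j` of `A`. -/
theorem one_add_dotProduct_inv_transpose {n : Type*} [Fintype n] [DecidableEq n]
    {A : Matrix n n ℝ} (hA : A.det ≠ 0) (c : n → ℝ) (j : n) :
    1 + (c - fun k => A k j) ⬝ᵥ (fun k => (A⁻¹).transpose k j) =
      (A.updateCol j c).det / A.det := by
  have h : (A.updateCol j fun k => A k j) = A := Matrix.updateCol_eq_self A j
  rw [dotProduct_comm, dotProduct_sub, inv_transpose_dotProduct, inv_transpose_dotProduct, h,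
    div_self hA]
  ring

/-- Sherman–Morrison: transposing turns the column replacement into adding `e_j uᵀ`, and column `j`
of `B` is the preimage of `e_j` under the transpose of `A`. The formula is checked by multiplying
out. -/
theorem inv_transpose_updateCol {n : Type*} [Fintype n] [DecidableEq n]
    {A B : Matrix n n ℝ} {c u : n → ℝ} {j : n} (hA : A.det ≠ 0)
    (hB : B = (A⁻¹).transpose) (hu : u = c - fun k => A k j)
    (h0 : 1 + u ⬝ᵥ (fun k => B k j) ≠ 0) :
    ((A.updateCol j c)⁻¹).transpose =
      B - (1 / (1 + u ⬝ᵥ (fun k => B k j))) •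
        Matrix.vecMulVec (fun k => B k j) (Matrix.vecMul u B) := by
  have hAB : A.transpose * B = 1 := by
    rw [hB, ← Matrix.transpose_mul, Matrix.nonsing_inv_mul _ (isUnit_iff_ne_zero.2 hA),
      Matrix.transpose_one]
  have hup : (A.updateCol j c).transpose = A.transpose + Matrix.vecMulVec (Pi.single j 1) u := by
    ext a b
    rw [Matrix.transpose_apply, Matrix.updateCol_apply, Matrix.add_apply, Matrix.vecMulVec_apply]
    by_cases h : a = j
    · subst h; simp [hu]
    · simp [h]
  have hcol : A.transpose.mulVec (fun k => B k j) = Pi.single j 1 := by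
    funext a
    have := congrFun (congrFun hAB a) j
    rw [Matrix.mul_apply] at this
    rw [Matrix.mulVec, dotProduct, this, Matrix.one_apply, Pi.single_apply]
  rw [Matrix.transpose_nonsing_inv]
  refine Matrix.inv_eq_right_inv ?_
  rw [hup, add_mul, mul_sub, mul_sub, hAB, Matrix.mul_smul, Matrix.mul_vecMulVec, hcol,
    Matrix.mul_smul, Matrix.vecMulVec_mul, Matrix.vecMulVec_mul_vecMulVec]
  set α := 1 + u ⬝ᵥ (fun k => B k j) with hα
  have hd : u ⬝ᵥ (fun k => B k j) = α - 1 := by rw [hα]; ring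
  ext a b
  simp only [hd, Matrix.add_apply, Matrix.sub_apply, Matrix.smul_apply, Matrix.vecMulVec_apply,
    Pi.smul_apply, smul_eq_mul]
  field_simp
  ring

/-- Conditioning selects a subset of the trees and keeps their weights, so a non-zero conditioned
partition function makes the original one non-zero. -/
theorem partition_condition_le (G : Graph N) (i : Fin (N + 1)) (j : Fin N) :
    (G.condition i j.succ).partition ≤ G.partition := by
  have h : ∀ t ∈ (G.condition i j.succ).depTrees, (G.condition i j.succ).weight t = G.weight t := by
    intro t ht
    refine prod_congr rfl fun e he => ?_
    have := (mem_filter.1 ((mem_depTrees.1 ht).1.1 he)).2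
    simp [condition, if_pos this]
  rw [partition, sum_congr rfl h]
  refine sum_le_sum_of_subset_of_nonneg (fun t ht => ?_) fun _ _ _ => G.weight_nonneg _
  rw [mem_depTrees] at ht ⊢
  exact ((isDependencyTree_condition_iff G i j t).1 ht).1

theorem partition_ne_zero_of_condition {G : Graph N} {i : Fin (N + 1)} {j : Fin N}
    (h : (G.condition i j.succ).partition ≠ 0) : G.partition ≠ 0 :=
  ((lt_of_le_of_ne (partition_nonneg _) h.symm).trans_le (partition_condition_le G i j)).ne'

theorem det_updateCol_edgeColumn (G : Graph N) (i : Fin (N + 1)) (j : Fin N) :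
    (G.laplacian.updateCol j (G.edgeColumn i j)).det = (G.condition i j.succ).partition := by
  rw [partition_eq_det j.pos, laplacian_condition]

theorem det_laplacian_ne_zero {G : Graph N} (hN : 1 ≤ N) (h : G.partition ≠ 0) :
    G.laplacian.det ≠ 0 := partition_eq_det hN G ▸ h

theorem one_add_dotProduct_ne_zero {G : Graph N} {i : Fin (N + 1)} {j : Fin N}
    (h : (G.condition i j.succ).partition ≠ 0) {B : Matrix (Fin N) (Fin N) ℝ} {u : Fin N → ℝ}
    (hB : B = (G.laplacian⁻¹).transpose) (hu : u = G.edgeColumn i j - fun k => G.laplacian k j) :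
    1 + u ⬝ᵥ (fun k => B k j) ≠ 0 := by
  have hA := det_laplacian_ne_zero j.pos (partition_ne_zero_of_condition h)
  rw [hu, hB, one_add_dotProduct_inv_transpose hA, det_updateCol_edgeColumn]
  exact div_ne_zero h hA

theorem inv_transpose_condition {G : Graph N} {i : Fin (N + 1)} {j : Fin N}
    (h : (G.condition i j.succ).partition ≠ 0) {B : Matrix (Fin N) (Fin N) ℝ} {u : Fin N → ℝ}
    (hB : B = (G.laplacian⁻¹).transpose) (hu : u = G.edgeColumn i j - fun k => G.laplacian k j) :
    ((G.condition i j.succ).laplacian⁻¹).transpose =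
      B - (1 / (1 + u ⬝ᵥ (fun k => B k j))) •
        Matrix.vecMulVec (fun k => B k j) (Matrix.vecMul u B) := by
  rw [laplacian_condition]
  exact inv_transpose_updateCol
    (det_laplacian_ne_zero j.pos (partition_ne_zero_of_condition h)) hB hu
    (one_add_dotProduct_ne_zero h hB hu)

/-- The probability that the incoming edge of `j.succ` is `i → j.succ`. -/
theorem marginal_eq (G : Graph N) (i : Fin (N + 1)) (j : Fin N) :
    (fun k => (G.laplacian⁻¹).transpose k j) ⬝ᵥ G.edgeColumn i j =
      (G.condition i j.succ).partition / G.partition := by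
  rw [inv_transpose_dotProduct, det_updateCol_edgeColumn, partition_eq_det j.pos G]

/-- The edge columns sum to column `j` of the Laplacian itself, so Cramer's rule gives `det L / det
L`. -/
theorem sum_marginal {G : Graph N} (h : G.partition ≠ 0) (j : Fin N) :
    ∑ i, (G.condition i j.succ).partition / G.partition = 1 := by
  have hA := det_laplacian_ne_zero j.pos h
  have hup : (G.laplacian.updateCol j fun k => G.laplacian k j) = G.laplacian :=
    Matrix.updateCol_eq_self _ j
  simp only [← marginal_eq]
  rw [← dotProduct_sum]
  have : ∑ i, G.edgeColumn i j = fun k => G.laplacian k j := by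
    funext k
    rw [Finset.sum_apply, sum_edgeColumn]
  rw [this, inv_transpose_dotProduct, hup, div_self hA]

/-! ## Conditioning on the first edges of a tree -/

/-- The graph in which the nodes `1, …, m` keep only the incoming edge given by `f`. -/
def restrict (G : Graph N) (f : Fin N → Fin (N + 1)) (m : ℕ) : Graph N where
  edges := G.edges.filter fun e => ∀ k : Fin N, k.val < m → e.2 = k.succ → e.1 = f k
  w := fun a b => if ∀ k : Fin N, k.val < m → b = k.succ → a = f k then G.w a b else 0
  w_nonneg := by
    intro a b
    split_ifs
    · exact G.w_nonneg a b
    · exact le_rfl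
  w_eq_zero := by
    intro a b h
    split_ifs with hab
    · exact G.w_eq_zero a b fun hm => h (mem_filter.2 ⟨hm, hab⟩)
    · rfl

theorem restrict_zero (G : Graph N) (f : Fin N → Fin (N + 1)) : G.restrict f 0 = G := by
  cases G
  simp [restrict]

/-- One pass of the sampling loop: indices are zero-based, so fixing the parent of node `j.succ`
takes `j` fixed nodes to `j + 1`. -/
theorem condition_restrict (G : Graph N) (f : Fin N → Fin (N + 1)) (j : Fin N) :
    (G.restrict f j.val).condition (f j) j.succ = G.restrict f (j.val + 1) := by
  have key : ∀ a b : Fin (N + 1),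
      (∀ k : Fin N, k.val < j.val + 1 → b = k.succ → a = f k) ↔
        (∀ k : Fin N, k.val < j.val → b = k.succ → a = f k) ∧ (b = j.succ → a = f j) := by
    intro a b
    constructor
    · exact fun h => ⟨fun k hk => h k (by omega), h j (by omega)⟩
    · rintro ⟨h1, h2⟩ k hk hb
      rcases Nat.lt_succ_iff_lt_or_eq.1 hk with h | h
      · exact h1 k h hb
      · obtain rfl := Fin.ext h
        exact h2 hb
  simp only [restrict, condition, Graph.mk.injEq]
  refine ⟨?_, ?_⟩
  · rw [filter_filter]
    exact filter_congr fun e _ => (key e.1 e.2).symm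
  · funext a b
    rw [if_congr (key a b) rfl rfl, ite_and]
    split_ifs <;> rfl

theorem restrict_w_of_le (G : Graph N) (f : Fin N → Fin (N + 1)) {m : ℕ} (a : Fin (N + 1))
    {j : Fin N} (h : m ≤ j.val) : (G.restrict f m).w a j.succ = G.w a j.succ := by
  refine if_pos fun k hk hj => ?_
  obtain rfl := Fin.succ_injective _ hj
  omega

/-- The program always reads the original weights; this is harmless since the column of the current
node has not been conditioned on yet. -/
theorem edgeColumn_restrict (G : Graph N) (f : Fin N → Fin (N + 1)) (a : Fin (N + 1))
    (j : Fin N) : (G.restrict f j.val).edgeColumn a j = G.edgeColumn a j := by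
  rw [edgeColumn_eq_smul, edgeColumn_eq_smul, restrict_w_of_le _ _ _ le_rfl]

/-- The tree of `f` survives every restriction. This keeps all the partition functions on its path
non-zero, and at `m = N` it bounds the telescoped numerator from below. -/
theorem weight_le_partition_restrict {G : Graph N} {f : Fin N → Fin (N + 1)}
    (h : G.IsDependencyTree (parentEdges f)) (m : ℕ) :
    G.weight (parentEdges f) ≤ (G.restrict f m).partition := by
  have ht : (G.restrict f m).IsDependencyTree (parentEdges f) := by
    refine ⟨⟨fun e he => mem_filter.2 ⟨h.1.1 he, fun k _ hk => ?_⟩, h.1.2⟩, h.2⟩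
    obtain ⟨a, b⟩ := e
    obtain rfl : b = k.succ := hk
    exact mem_parentEdges_succ.1 he
  have hw : G.weight (parentEdges f) = (G.restrict f m).weight (parentEdges f) := by
    rw [weight_parentEdges, weight_parentEdges]
    refine prod_congr rfl fun j _ => (if_pos fun k _ hj => ?_).symm
    rw [Fin.succ_injective _ hj]
  rw [hw]
  exact single_le_sum (f := (G.restrict f m).weight) (fun _ _ => weight_nonneg _ _)
    (mem_depTrees.2 ht)

end Graph

/-! ## Running time -/

/-- No command writes the register `n`, and all loops and samples have the upper limit `n`. -/
def Cmd.Tame : Cmd → Prop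
  | .seq c d => c.Tame ∧ d.Tame
  | .setI v _ => v ≠ .n
  | .ite _ c d => c.Tame ∧ d.Tame
  | .loop v _ hi c => v ≠ .n ∧ hi = .var .n ∧ c.Tame
  | .sample v _ hi => v ≠ .n ∧ hi = .var .n
  | _ => True

/-- A bound for the number of steps of a tame command when `n` holds `N`. -/
def Cmd.bound (N : ℕ) : Cmd → ℕ
  | .skip => 0
  | .fail => 1
  | .seq c d => c.bound N + d.bound N
  | .setI _ _ => 1
  | .setR _ e => e.cost + 1
  | .div _ e f => e.cost + f.cost + 1
  | .put _ _ _ e => e.cost + 1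
  | .emit _ _ => 1
  | .ite b c d => b.cost + (c.bound N + d.bound N)
  | .loop _ _ _ c => (N + 1) * (c.bound N + 1) + 1
  | .sample _ _ _ => N + 2

namespace Run

/-- All runs take at most `b` steps and leave `N` in the register `n`. -/
def Within (N b : ℕ) (r : Run) : Prop :=
  ∀ q ∈ r.support, q.2 ≤ b ∧ ∀ s, q.1 = some s → s.ints .n = N

theorem Within.mono {N b b' : ℕ} {r : Run} (h : Within N b r) (hb : b ≤ b') : Within N b' r :=
  fun q hq => ⟨(h q hq).1.trans hb, (h q hq).2⟩

theorem within_ret {N : ℕ} {s : State} (h : s.ints .n = N) : Within N 0 (ret s) := by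
  intro q hq
  rw [ret, PMF.mem_support_pure_iff] at hq
  subst hq
  simp [h]

theorem within_abort {N : ℕ} : Within N 0 abort := by
  intro q hq
  rw [abort, PMF.mem_support_pure_iff] at hq
  subst hq
  simp

theorem Within.tick {N b : ℕ} {r : Run} (h : Within N b r) (a : ℕ) :
    Within N (b + a) (r.tick a) := by
  intro q hq
  obtain ⟨q', hq', rfl⟩ := (PMF.mem_support_map_iff _ _ _).1 hq
  exact ⟨Nat.add_le_add_right (h q' hq').1 a, (h q' hq').2⟩

theorem Within.andThen {N b b' : ℕ} {r : Run} {f : State → Run} (h : Within N b r)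
    (hf : ∀ s, s.ints .n = N → Within N b' (f s)) : Within N (b + b') (r.andThen f) := by
  intro q hq
  obtain ⟨⟨o, k⟩, hq', hq⟩ := (PMF.mem_support_bind_iff _ _ _).1 hq
  obtain ⟨hk, hs⟩ := h _ hq'
  cases o with
  | none =>
    rw [PMF.mem_support_pure_iff] at hq
    subst hq
    exact ⟨hk.trans (Nat.le_add_right _ _), by simp⟩
  | some s =>
    refine ((hf s (hs s rfl)).tick k).mono ?_ q hq
    simp only at hk
    omega

theorem within_iterate {N b : ℕ} {z : IVar} (hz : z ≠ .n) {body : State → Run}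
    (hb : ∀ s, s.ints .n = N → Within N b (body s)) (l : List ℕ) :
    ∀ s, s.ints .n = N → Within N (l.length * (b + 1)) (iterate z body l s) := by
  induction l with
  | nil => exact fun s hs => (within_ret hs).mono (Nat.zero_le _)
  | cons v vs ih =>
    intro s hs
    have h1 : (s.setI z v).ints .n = N := by
      simpa [State.setI, Function.update_of_ne hz.symm] using hs
    refine (((hb _ h1).tick 1).andThen ih).mono ?_
    rw [List.length_cons]
    exact le_of_eq (by ring)

end Run

/-- The invariant that `n` still holds `N` is proved together with the bound, since it limits the
later loops and samples. -/
theorem Cmd.within_bound {N : ℕ} (c : Cmd) (hc : c.Tame) :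
    ∀ s, s.ints .n = N → Run.Within N (c.bound N) (c.exec s) := by
  induction c with
  | skip => exact fun s hs => Run.within_ret hs
  | fail => exact fun s hs => (Run.within_abort.tick 1).mono (by simp [bound])
  | seq c d ihc ihd => exact fun s hs => (ihc hc.1 s hs).andThen (ihd hc.2)
  | setI v r =>
    intro s hs
    refine ((Run.within_ret ?_).tick 1).mono (by simp [bound])
    simpa [State.setI, Function.update_of_ne (Ne.symm hc)] using hs
  | setR v e =>
    intro s hs
    refine ((Run.within_ret ?_).tick _).mono (Nat.zero_add _).le
    exact hs
  | div v e f =>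
    intro s hs
    rw [exec]
    split_ifs
    · exact (Run.within_abort.tick _).mono (by simp [bound])
    · refine ((Run.within_ret ?_).tick _).mono (Nat.zero_add _).le
      exact hs
  | put a i j e =>
    intro s hs
    refine ((Run.within_ret ?_).tick _).mono (Nat.zero_add _).le
    exact hs
  | emit i j =>
    intro s hs
    refine ((Run.within_ret ?_).tick _).mono (Nat.zero_add _).le
    exact hs
  | ite b c d ihc ihd =>
    intro s hs
    rw [exec]
    split_ifs
    · exact ((ihc hc.1 s hs).tick _).mono (by rw [bound]; omega)
    · exact ((ihd hc.2 s hs).tick _).mono (by rw [bound]; omega)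
  | loop v lo hi c ih =>
    obtain ⟨hv, rfl, hc⟩ := hc
    intro s hs
    refine ((Run.within_iterate hv (ih hc) _ s hs).tick 1).mono ?_
    rw [List.length_range', bound]
    -- The lower limit of a loop is arbitrary and may be 0, hence `N + 1` iterations in the bound.
    refine Nat.add_le_add_right (Nat.mul_le_mul_right _ ?_) 1
    simp only [Ref.eval, hs]
    exact Nat.sub_le _ _
  | sample v a hi =>
    obtain ⟨hv, rfl⟩ := hc
    intro s hs
    rw [exec]
    split_ifs with hm
    · have : Run.Within N 0 (PMF.map (fun b => (some (s.setI v b), 0))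
          (probVec (s.mem a 0) (Ref.eval s (.var .n)) hm)) := by
        intro q hq
        obtain ⟨b, -, rfl⟩ := (PMF.mem_support_map_iff _ _ _).1 hq
        simpa [State.setI, Function.update_of_ne hv.symm] using hs
      exact (this.tick _).mono (by simp [bound, Ref.eval, hs])
    · exact (Run.within_abort.tick _).mono (by simp [bound, Ref.eval, hs])

theorem colbourn_tame : Prog.colbourn.Tame := by
  simp [Prog.colbourn, Prog.laplacian, Prog.inverseTranspose, Prog.sampleEdge, Prog.condition,
    Prog.swapRows, Prog.scaleRow, Prog.subRow, Cmd.Tame]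

theorem colbourn_bound_le {N : ℕ} (hN : 1 ≤ N) : Prog.colbourn.bound N ≤ 10000 * N ^ 3 := by
  -- Lower powers are absorbed into the cube. The constant 10000 is not sharp; it only has to exceed
  -- the sum of the coefficients of the bound polynomial.
  have h1 : N ≤ N ^ 3 := Nat.le_self_pow (by norm_num) N
  have h2 : N ^ 2 ≤ N ^ 3 := Nat.pow_le_pow_right hN (by norm_num)
  simp only [Prog.colbourn, Prog.laplacian, Prog.inverseTranspose, Prog.sampleEdge, Prog.condition,
    Prog.swapRows, Prog.scaleRow, Prog.subRow, Cmd.bound, Expr.cost, Test.cost]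
  ring_nf
  omega

theorem colbournRun_cost_le {N : ℕ} (hN : 1 ≤ N) (G : Graph N) {q : Option State × ℕ}
    (hq : q ∈ (colbournRun G).support) : q.2 ≤ 10000 * N ^ 3 :=
  ((Cmd.within_bound Prog.colbourn colbourn_tame (initState G) rfl q hq).1).trans
    (colbourn_bound_le hN)

/-! ## Reasoning about runs of positive probability -/

/-- The parts of a machine state. -/
inductive Loc
  | int (v : IVar)
  | real (v : RVar)
  | arr (a : Arr)
  | out
  deriving DecidableEq

/-- The parts of the state that a command can change. -/
def Cmd.writes : Cmd → Loc → Bool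
  | .skip, _ => false
  | .fail, _ => false
  | .seq c d, l => c.writes l || d.writes l
  | .setI v _, l => decide (l = .int v)
  | .setR v _, l => decide (l = .real v)
  | .div v _ _, l => decide (l = .real v)
  | .put a _ _ _, l => decide (l = .arr a)
  | .emit _ _, l => decide (l = .out)
  | .ite _ c d, l => c.writes l || d.writes l
  | .loop v _ _ c, l => decide (l = .int v) || c.writes l
  | .sample v _ _, l => decide (l = .int v)

/-- Two states agree outside of a set of locations. -/
structure AgreeOff (w : Loc → Bool) (s s' : State) : Prop where
  int : ∀ v, w (.int v) = false → s'.ints v = s.ints v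
  real : ∀ v, w (.real v) = false → s'.reals v = s.reals v
  arr : ∀ a, w (.arr a) = false → s'.mem a = s.mem a
  out : w .out = false → s'.out = s.out

namespace AgreeOff

theorem refl (w : Loc → Bool) (s : State) : AgreeOff w s s :=
  ⟨fun _ _ => rfl, fun _ _ => rfl, fun _ _ => rfl, fun _ => rfl⟩

theorem trans {w : Loc → Bool} {s s' s'' : State} (h : AgreeOff w s s') (h' : AgreeOff w s' s'') :
    AgreeOff w s s'' :=
  ⟨fun v hv => (h'.int v hv).trans (h.int v hv), fun v hv => (h'.real v hv).trans (h.real v hv),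
    fun v hv => (h'.arr v hv).trans (h.arr v hv), fun hv => (h'.out hv).trans (h.out hv)⟩

theorem mono {w w' : Loc → Bool} {s s' : State} (h : AgreeOff w s s')
    (hw : ∀ l, w' l = false → w l = false) : AgreeOff w' s s' :=
  ⟨fun v hv => h.int v (hw _ hv), fun v hv => h.real v (hw _ hv), fun v hv => h.arr v (hw _ hv),
    fun hv => h.out (hw _ hv)⟩

theorem setI (s : State) (v : IVar) (a : ℕ) {w : Loc → Bool} (hw : w (.int v) = true) :
    AgreeOff w s (s.setI v a) := by
  refine ⟨fun u hu => Function.update_of_ne ?_ _ _, fun _ _ => rfl, fun _ _ => rfl, fun _ => rfl⟩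
  rintro rfl
  simp [hw] at hu

theorem setR (s : State) (v : RVar) (a : ℝ) {w : Loc → Bool} (hw : w (.real v) = true) :
    AgreeOff w s (s.setR v a) := by
  refine ⟨fun _ _ => rfl, fun u hu => Function.update_of_ne ?_ _ _, fun _ _ => rfl, fun _ => rfl⟩
  rintro rfl
  simp [hw] at hu

theorem put (s : State) (a : Arr) (i j : ℕ) (v : ℝ) {w : Loc → Bool} (hw : w (.arr a) = true) :
    AgreeOff w s (s.put a i j v) := by
  refine ⟨fun _ _ => rfl, fun _ _ => rfl, fun u hu => Function.update_of_ne ?_ _ _, fun _ => rfl⟩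
  rintro rfl
  simp [hw] at hu

theorem emit (s : State) (i j : ℕ) {w : Loc → Bool} (hw : w .out = true) :
    AgreeOff w s (s.emit i j) :=
  ⟨fun _ _ => rfl, fun _ _ => rfl, fun _ _ => rfl, fun h => by simp [hw] at h⟩

end AgreeOff

namespace State

@[simp] theorem setI_ints (s : State) (v u : IVar) (a : ℕ) :
    (s.setI v a).ints u = if u = v then a else s.ints u := Function.update_apply ..

@[simp] theorem setI_reals (s : State) (v : IVar) (a : ℕ) : (s.setI v a).reals = s.reals := rfl

@[simp] theorem setI_mem (s : State) (v : IVar) (a : ℕ) : (s.setI v a).mem = s.mem := rfl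

@[simp] theorem setR_reals (s : State) (v u : RVar) (a : ℝ) :
    (s.setR v a).reals u = if u = v then a else s.reals u := Function.update_apply ..

@[simp] theorem setR_ints (s : State) (v : RVar) (a : ℝ) : (s.setR v a).ints = s.ints := rfl

@[simp] theorem setR_mem (s : State) (v : RVar) (a : ℝ) : (s.setR v a).mem = s.mem := rfl

@[simp] theorem put_mem (s : State) (a b : Arr) (i j r c : ℕ) (v : ℝ) :
    (s.put a i j v).mem b r c = if b = a ∧ r = i ∧ c = j then v else s.mem b r c := by
  simp only [put, Function.update_apply]
  by_cases hb : b = a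
  · subst hb
    by_cases hr : r = i
    · subst hr
      simp [Function.update_apply]
    · simp [hr]
  · simp [hb]

@[simp] theorem put_ints (s : State) (a : Arr) (i j : ℕ) (v : ℝ) :
    (s.put a i j v).ints = s.ints := rfl

@[simp] theorem put_reals (s : State) (a : Arr) (i j : ℕ) (v : ℝ) :
    (s.put a i j v).reals = s.reals := rfl

@[simp] theorem emit_ints (s : State) (i j : ℕ) : (s.emit i j).ints = s.ints := rfl

@[simp] theorem emit_mem (s : State) (i j : ℕ) : (s.emit i j).mem = s.mem := rfl

@[simp] theorem emit_out (s : State) (i j : ℕ) : (s.emit i j).out = s.out ++ [(i, j)] := rfl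

end State

attribute [simp] Ref.eval Expr.eval Test.holds

/-! ### Lower bounds for the probability of a single execution path. -/

namespace Run

/-- With probability at least `p`, the run ends in the state `s` (with some number of steps). -/
def Hits (r : Run) (p : ENNReal) (s : State) : Prop := ∃ k, p ≤ r (some s, k)

theorem hits_ret (s : State) : Hits (ret s) 1 s := ⟨0, by simp [ret]⟩

theorem le_map_apply {α β : Type*} (f : α → β) (r : PMF α) (a : α) : r a ≤ r.map f (f a) := by
  rw [PMF.map_apply]
  exact le_trans (by simp) (ENNReal.le_tsum a)

theorem Hits.tick {r : Run} {p : ENNReal} {s : State} (h : Hits r p s) (a : ℕ) :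
    Hits (r.tick a) p s := by
  obtain ⟨k, hk⟩ := h
  exact ⟨k + a, hk.trans (le_map_apply (fun q : Option State × ℕ => (q.1, q.2 + a)) r (some s, k))⟩

theorem Hits.andThen {r : Run} {f : State → Run} {p p' : ENNReal} {s s' : State}
    (h : Hits r p s) (h' : Hits (f s) p' s') : Hits (r.andThen f) (p * p') s' := by
  obtain ⟨k, hk⟩ := h
  obtain ⟨l, hl⟩ := h'.tick k
  refine ⟨l, ?_⟩
  rw [Run.andThen, PMF.bind_apply]
  exact le_trans (mul_le_mul' hk hl) (ENNReal.le_tsum (some s, k))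

end Run

/-- With probability at least `p`, the command ends in some particular state that satisfies `Q`,
and which differs from the initial state only where the command writes. -/
def Reach (c : Cmd) (s : State) (p : ENNReal) (Q : State → Prop) : Prop :=
  ∃ s', Q s' ∧ AgreeOff c.writes s s' ∧ Run.Hits (c.exec s) p s'

namespace Reach

variable {c d : Cmd} {s : State} {p q : ENNReal} {Q R : State → Prop}

theorem mono (h : Reach c s p R) (hQ : ∀ s', R s' → Q s') : Reach c s p Q := by
  obtain ⟨s', h1, h2, h3⟩ := h
  exact ⟨s', hQ s' h1, h2, h3⟩

theorem withAgree (h : Reach c s p Q) : Reach c s p fun s' => Q s' ∧ AgreeOff c.writes s s' := by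
  obtain ⟨s', h1, h2, h3⟩ := h
  exact ⟨s', ⟨h1, h2⟩, h2, h3⟩

/-- The second command may use that the first left everything outside its write set alone. As
`Cmd.writes` computes, such facts are later obtained with `rfl`. -/
theorem seq_mul
    (h : Reach c s p fun s' => AgreeOff c.writes s s' → Reach d s' q Q) :
    Reach (.seq c d) s (p * q) Q := by
  obtain ⟨s', h1, h2, h3⟩ := h
  obtain ⟨s'', h4, h5, h6⟩ := h1 h2
  refine ⟨s'', h4, (h2.mono ?_).trans (h5.mono ?_), h3.andThen h6⟩ <;>
  · intro l hl
    simp only [Cmd.writes, Bool.or_eq_false_iff] at hl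
    simp [hl]

theorem seq (h : Reach c s 1 fun s' => AgreeOff c.writes s s' → Reach d s' q Q) :
    Reach (.seq c d) s q Q := one_mul q ▸ seq_mul h

theorem skip (h : Q s) : Reach .skip s 1 Q := ⟨s, h, .refl _ _, Run.hits_ret s⟩

theorem setI {v : IVar} {r : Ref} (h : Q (s.setI v (r.eval s))) : Reach (.setI v r) s 1 Q :=
  ⟨_, h, .setI _ _ _ (by simp [Cmd.writes]), (Run.hits_ret _).tick 1⟩

theorem setR {v : RVar} {e : Expr} (h : Q (s.setR v (e.eval s))) : Reach (.setR v e) s 1 Q :=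
  ⟨_, h, .setR _ _ _ (by simp [Cmd.writes]), (Run.hits_ret _).tick _⟩

theorem put {a : Arr} {i j : Ref} {e : Expr} (h : Q (s.put a (i.eval s) (j.eval s) (e.eval s))) :
    Reach (.put a i j e) s 1 Q :=
  ⟨_, h, .put _ _ _ _ _ (by simp [Cmd.writes]), (Run.hits_ret _).tick _⟩

theorem emit {i j : Ref} (h : Q (s.emit (i.eval s) (j.eval s))) : Reach (.emit i j) s 1 Q :=
  ⟨_, h, .emit _ _ _ (by simp [Cmd.writes]), (Run.hits_ret _).tick 1⟩

theorem div {v : RVar} {e f : Expr} (h0 : f.eval s ≠ 0)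
    (h : Q (s.setR v (e.eval s / f.eval s))) : Reach (.div v e f) s 1 Q := by
  refine ⟨_, h, .setR _ _ _ (by simp [Cmd.writes]), ?_⟩
  rw [Cmd.exec, if_neg h0]
  exact (Run.hits_ret _).tick _

theorem ite {b : Test} (h1 : b.holds s → Reach c s p Q) (h2 : ¬ b.holds s → Reach d s p Q) :
    Reach (.ite b c d) s p Q := by
  by_cases hb : b.holds s
  · obtain ⟨s', h3, h4, h5⟩ := h1 hb
    refine ⟨s', h3, h4.mono fun l hl => ?_, ?_⟩
    · simp only [Cmd.writes, Bool.or_eq_false_iff] at hl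
      exact hl.1
    · rw [Cmd.exec, if_pos hb]
      exact h5.tick _
  · obtain ⟨s', h3, h4, h5⟩ := h2 hb
    refine ⟨s', h3, h4.mono fun l hl => ?_, ?_⟩
    · simp only [Cmd.writes, Bool.or_eq_false_iff] at hl
      exact hl.2
    · rw [Cmd.exec, if_neg hb]
      exact h5.tick _

/-- The state `s₀` at loop entry stays fixed through the induction, so each pass can compare its
state with the one at entry. -/
theorem iterate {v : IVar} {lo cnt : ℕ} {P : ℕ → ENNReal} {w : Loc → Bool} {s₀ : State}
    {Inv : ℕ → State → Prop} (hw : w (.int v) = true) (hcw : ∀ l, w l = false → c.writes l = false)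
    (hbody : ∀ m s', lo ≤ m → m < lo + cnt → Inv m s' → AgreeOff w s₀ s' →
      Reach c (s'.setI v m) (P m) (Inv (m + 1)))
    (h : Inv lo s) (hs : AgreeOff w s₀ s) :
    ∃ s', Inv (lo + cnt) s' ∧ AgreeOff w s₀ s' ∧
      Run.Hits (Run.iterate v c.exec (List.range' lo cnt) s) (∏ m ∈ Finset.Ico lo (lo + cnt), P m)
        s' := by
  induction cnt generalizing lo s with
  | zero => exact ⟨s, h, hs, by simpa [Run.iterate] using Run.hits_ret s⟩
  | succ cnt ih =>
    obtain ⟨s1, h1, h2, h3⟩ := hbody lo s le_rfl (by omega) h hs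
    have a1 : AgreeOff w s₀ s1 := (hs.trans (.setI _ _ _ hw)).trans (h2.mono hcw)
    obtain ⟨s2, h4, h5, h6⟩ := ih (lo := lo + 1)
      (fun m s' hm hm' => hbody m s' (by omega) (by omega)) h1 a1
    have e : lo + 1 + cnt = lo + (cnt + 1) := by omega
    rw [e] at h4 h6
    refine ⟨s2, h4, h5, ?_⟩
    rw [Finset.prod_eq_prod_Ico_succ_bot (by omega)]
    exact (h3.tick 1).andThen h6

/-- `Inv m` describes the state before the pass with value `m`. The condition `hle` makes the
truncated subtraction in the iteration count exact. -/
theorem loop_prod {v : IVar} {lo hi : Ref} {P : ℕ → ENNReal} (Inv : ℕ → State → Prop)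
    (hle : lo.eval s ≤ hi.eval s + 1)
    (h : Inv (lo.eval s) s)
    (hbody : ∀ m s', lo.eval s ≤ m → m ≤ hi.eval s → Inv m s' →
      AgreeOff (Cmd.loop v lo hi c).writes s s' → Reach c (s'.setI v m) (P m) (Inv (m + 1))) :
    Reach (.loop v lo hi c) s (∏ m ∈ Finset.Ico (lo.eval s) (hi.eval s + 1), P m)
      (Inv (hi.eval s + 1)) := by
  obtain ⟨s', h1, h2, h3⟩ := iterate (s₀ := s) (cnt := hi.eval s + 1 - lo.eval s)
    (w := (Cmd.loop v lo hi c).writes) (by simp [Cmd.writes])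
    (fun l hl => by
      simp only [Cmd.writes, Bool.or_eq_false_iff] at hl
      exact hl.2)
    (fun m s' hm hm' => hbody m s' hm (by omega)) h (.refl _ _)
  rw [Nat.add_sub_cancel' hle] at h1 h3
  exact ⟨s', h1, h2, h3.tick 1⟩

theorem loop {v : IVar} {lo hi : Ref} (Inv : ℕ → State → Prop)
    (hle : lo.eval s ≤ hi.eval s + 1)
    (h : Inv (lo.eval s) s)
    (hbody : ∀ m s', lo.eval s ≤ m → m ≤ hi.eval s → Inv m s' →
      AgreeOff (Cmd.loop v lo hi c).writes s s' → Reach c (s'.setI v m) 1 (Inv (m + 1))) :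
    Reach (.loop v lo hi c) s 1 (Inv (hi.eval s + 1)) := by
  simpa using loop_prod (P := fun _ => 1) Inv hle h hbody

theorem each {v : IVar} {N : ℕ} (Inv : ℕ → State → Prop) (hn : s.ints .n = N)
    (h : Inv 1 s)
    (hbody : ∀ m s', 1 ≤ m → m ≤ N → Inv m s' →
      AgreeOff (Prog.each v c).writes s s' → Reach c (s'.setI v m) 1 (Inv (m + 1))) :
    Reach (Prog.each v c) s 1 (Inv (N + 1)) := by
  subst hn
  exact loop Inv (by simp) h hbody

theorem sample {v : IVar} {a : Arr} {hi : Ref} {b : ℕ} (hm : IsProbVec (s.mem a 0) (hi.eval s))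
    (hb : b ≤ hi.eval s) (h : Q (s.setI v b)) :
    Reach (.sample v a hi) s (ENNReal.ofReal (s.mem a 0 b)) Q := by
  refine ⟨_, h, .setI _ _ _ (by simp [Cmd.writes]), ?_⟩
  rw [Cmd.exec, dif_pos hm]
  refine Run.Hits.tick ⟨0, le_trans ?_ (Run.le_map_apply _ _ b)⟩ _
  rw [probVec, PMF.ofFinset_apply, if_pos (Finset.mem_range.2 (by omega))]

end Reach

namespace Reach

variable {c : Cmd} {s : State} {v : IVar} {N : ℕ}

/-- A loop that writes the entries `1, …, N` of a row of an array, one in each iteration. -/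
theorem each_row (a : Arr) (r₀ : ℕ) (F : ℕ → ℝ) (hn : s.ints .n = N)
    (hbody : ∀ m s', 1 ≤ m → m ≤ N → AgreeOff (Prog.each v c).writes s s' →
      (∀ r c, s'.mem a r c = if r = r₀ ∧ 1 ≤ c ∧ c < m then F c else s.mem a r c) →
      Reach c (s'.setI v m) 1
        fun s'' => ∀ r c, s''.mem a r c = if r = r₀ ∧ c = m then F m else s'.mem a r c) :
    Reach (Prog.each v c) s 1
      fun s' => ∀ r c, s'.mem a r c = if r = r₀ ∧ 1 ≤ c ∧ c ≤ N then F c else s.mem a r c := by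
  refine mono (each (N := N) (fun m s' => ∀ r c, s'.mem a r c =
    if r = r₀ ∧ 1 ≤ c ∧ c < m then F c else s.mem a r c) hn ?_ ?_) ?_
  · intro r c
    rw [if_neg (by omega)]
  · intro m s' h1 h2 hI ha
    refine mono (hbody m s' h1 h2 ha hI) fun s'' h r c => ?_
    rw [h, hI]
    split_ifs <;> first | rfl | omega | simp_all
  · intro s' h r c
    simp only [h, Nat.lt_succ_iff]

/-- A loop that writes the part `1, …, N` of the rows `1, …, N` of an array, one row in each
iteration. -/
theorem each_rows (a : Arr) (F : ℕ → ℕ → ℝ) (hn : s.ints .n = N)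
    (hbody : ∀ m s', 1 ≤ m → m ≤ N → AgreeOff (Prog.each v c).writes s s' →
      (∀ r c, s'.mem a r c =
        if 1 ≤ r ∧ r < m ∧ 1 ≤ c ∧ c ≤ N then F r c else s.mem a r c) →
      Reach c (s'.setI v m) 1
        fun s'' => ∀ r c, s''.mem a r c =
          if r = m ∧ 1 ≤ c ∧ c ≤ N then F r c else s'.mem a r c) :
    Reach (Prog.each v c) s 1
      fun s' => ∀ r c, s'.mem a r c =
        if 1 ≤ r ∧ r ≤ N ∧ 1 ≤ c ∧ c ≤ N then F r c else s.mem a r c := by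
  refine mono (each (N := N) (fun m s' => ∀ r c, s'.mem a r c =
    if 1 ≤ r ∧ r < m ∧ 1 ≤ c ∧ c ≤ N then F r c else s.mem a r c) hn ?_ ?_) ?_
  · intro r c
    rw [if_neg (by omega)]
  · intro m s' h1 h2 hI ha
    refine mono (hbody m s' h1 h2 ha hI) fun s'' h r c => ?_
    rw [h, hI]
    split_ifs <;> first | rfl | omega
  · intro s' h r c
    simp only [h, Nat.lt_succ_iff]

end Reach

/-! ## The Laplacian -/

/-- The root-constrained Laplacian of a weight array with indices from `1`. -/
noncomputable def natLaplacian (N : ℕ) (W : ℕ → ℕ → ℝ) (i j : ℕ) : ℝ :=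
  if i = 1 then W 0 j
  else if i = j then ∑ k ∈ Finset.Ico 1 (N + 1), if k = j then 0 else W k j
  else - W i j

/-- The diagonal entry is accumulated in place, which is why the invariant records that columns not
yet visited are zero. Whatever the inner loop leaves in row 1 is overwritten by the root weight. -/
theorem laplacian_spec {N : ℕ} {s : State} (hn : s.ints .n = N)
    (hL : ∀ r c, s.mem .L r c = 0) :
    Reach Prog.laplacian s 1 fun s' => ∀ r c, 1 ≤ r → r ≤ N → 1 ≤ c → c ≤ N →
      s'.mem .L r c = natLaplacian N (s.mem .W) r c := by
  refine .mono (Reach.each (N := N) (fun m s' => (∀ r c, 1 ≤ r → r ≤ N → 1 ≤ c → c < m →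
    s'.mem .L r c = natLaplacian N (s.mem .W) r c) ∧ ∀ r c, m ≤ c → s'.mem .L r c = 0) hn
    ⟨by intros; omega, fun r c _ => hL r c⟩ ?_) fun s' h r c h1 h2 h3 h4 =>
      h.1 r c h1 h2 h3 (by omega)
  intro m s1 hm1 hm2 ⟨hI, h0⟩ a1
  have hn1 : s1.ints .n = N := (a1.int .n rfl).trans hn
  have hW1 : s1.mem .W = s.mem .W := a1.arr .W rfl
  refine .seq (.mono (Reach.each (N := N) (fun l s' => ∀ r c, s'.mem .L r c =
    if c = m then
      if r = m then ∑ k ∈ Finset.Ico 1 l, if k = m then 0 else s.mem .W k m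
      else if 1 ≤ r ∧ r < l then - s.mem .W r m else 0
    else s1.mem .L r c) (by simpa using hn1) ?_ ?_) fun s2 h2 a2 => .put ?_)
  · intro r c
    by_cases hc : c = m
    · subst hc
      have : ¬ (1 ≤ r ∧ r < 1) := by omega
      simp only [if_neg this]
      simp [h0]
    · simp [hc]
  · intro l s2 hl1 hl2 hI2 a2
    have hj : s2.ints .j = m := by rw [a2.int .j rfl]; simp
    have hW2 : s2.mem .W = s.mem .W := (a2.arr .W rfl).trans hW1
    refine .ite (fun h => .skip ?_) fun h => .seq (.put fun _ => .put ?_)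
    · simp [hj] at h
      subst h
      intro r c
      rw [State.setI_mem, hI2]
      split_ifs <;> first | rfl | omega | simp [Finset.sum_Ico_succ_top hl1]
    · simp [hj] at h
      intro r c
      simp [hj, hI2, hW2]
      by_cases hc : c = m
      · subst hc
        by_cases hr : r = c
        · subst hr
          have : ¬ r = l := fun e => h e.symm
          simp [h, this, Finset.sum_Ico_succ_top hl1]
        · by_cases hrl : r = l
          · subst hrl
            simp [hr, hl1]
          · have : (1 ≤ r ∧ r ≤ l) ↔ (1 ≤ r ∧ r < l) := by omega
            simp [hr, hrl, this]
      · simp [hc]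
  · have hj : s2.ints .j = m := by rw [a2.int .j rfl]; simp
    have hW2 : s2.mem .W = s.mem .W := (a2.arr .W rfl).trans hW1
    refine ⟨fun r c hr1 hr2 hc1 hc2 => ?_, fun r c hc => ?_⟩
    · simp only [State.put_mem, Ref.eval, Expr.eval, hj, h2, hW2, natLaplacian, true_and]
      by_cases hc : c = m
      · subst hc
        by_cases hr : r = 1
        · simp [hr]
        · have : r < N + 1 := by omega
          simp [hr, hr1, this]
      · simp only [hc, and_false, if_false]
        rw [hI r c hr1 hr2 hc1 (by omega), natLaplacian]
    · have : c ≠ m := by omega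
      simp [hj, h2, this, h0 r c (by omega)]

/-! ## Gauss–Jordan elimination -/

theorem swapRows_spec {N : ℕ} {s : State} (a : Arr) (hn : s.ints .n = N) :
    Reach (Prog.swapRows a) s 1 fun s' => ∀ r c, s'.mem a r c =
      if 1 ≤ c ∧ c ≤ N then
        s.mem a (if r = s.ints .k then s.ints .p else if r = s.ints .p then s.ints .k else r) c
      else s.mem a r c := by
  refine .mono (Reach.each (N := N) (fun m s' => ∀ r c, s'.mem a r c =
      if 1 ≤ c ∧ c < m then
        s.mem a (if r = s.ints .k then s.ints .p else if r = s.ints .p then s.ints .k else r) c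
      else s.mem a r c) hn ?_ ?_) ?_
  · intro r c
    rw [if_neg (by omega)]
  · intro m s' h1 h2 hI ha
    have hk : s'.ints .k = s.ints .k := ha.int .k rfl
    have hp : s'.ints .p = s.ints .p := ha.int .p rfl
    refine .seq (.setR fun _ => .seq (.put fun _ => .put ?_))
    intro r c
    simp [hk, hp, hI]
    by_cases hc : c = m
    · subst hc
      simp [h1]
      split_ifs <;> simp_all
    · have : (1 ≤ c ∧ c ≤ m) ↔ (1 ≤ c ∧ c < m) := by omega
      simp [hc, this]
  · intro s' h r c
    simp only [h, Nat.lt_succ_iff]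

theorem scaleRow_spec {N : ℕ} {s : State} (a : Arr) (hn : s.ints .n = N)
    (hx : s.reals .x ≠ 0) :
    Reach (Prog.scaleRow a) s 1 fun s' => ∀ r c, s'.mem a r c =
      if r = s.ints .k ∧ 1 ≤ c ∧ c ≤ N then s.mem a (s.ints .k) c / s.reals .x
      else s.mem a r c := by
  refine Reach.each_row a _ (fun c => s.mem a (s.ints .k) c / s.reals .x) hn ?_
  intro m s' h1 h2 ha hI
  have hk : s'.ints .k = s.ints .k := ha.int .k rfl
  have hx' : s'.reals .x = s.reals .x := ha.real .x rfl
  refine .seq (.div (by simpa [hx'] using hx) fun _ => .put ?_)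
  intro r c
  simp [hk, hx']
  simp [hI]

theorem subRow_spec {N : ℕ} {s : State} (a : Arr) (hn : s.ints .n = N) :
    Reach (Prog.subRow a) s 1 fun s' => ∀ r c, s'.mem a r c =
      if r = s.ints .i ∧ 1 ≤ c ∧ c ≤ N then
        s.mem a (s.ints .i) c - s.reals .x * s.mem a (s.ints .k) c
      else s.mem a r c := by
  refine Reach.each_row a _
    (fun c => s.mem a (s.ints .i) c - s.reals .x * s.mem a (s.ints .k) c) hn ?_
  intro m s' h1 h2 ha hI
  have hk : s'.ints .k = s.ints .k := ha.int .k rfl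
  have hi : s'.ints .i = s.ints .i := ha.int .i rfl
  have hx' : s'.reals .x = s.reals .x := ha.real .x rfl
  refine .put ?_
  intro r c
  simp [hk, hx', hi, hI]

open Prog in
/-- Search a pivot in the column `k`, at or below the row `k`, and store its row in `p`. -/
def pivotSearch : Cmd :=
  .loop .i k n (.ite (.isZero (.get .A i k)) .skip (.setI .p i))

open Prog in
/-- Subtract multiples of the row `k` from the other rows, to clear the column `k` of `A`. -/
def eliminate : Cmd :=
  each .i (
    .ite (.eq i k) .skip (
      .seq (.setR .x (.get .A i k)) (.seq (subRow .A) (subRow .C))))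

open Prog in
/-- The elimination step for the column `k`, after the pivot search. -/
def pivotStep : Cmd :=
  .seq (.ite (.eq p zero) .fail .skip) <|
  .seq (swapRows .A) <| .seq (swapRows .C) <| .seq (.setR .x (.get .A k k)) <|
  .seq (scaleRow .A) <| .seq (scaleRow .C) eliminate

/-- Rows are numbered from 1, so `p = 0` means that no non-zero entry has been seen; otherwise `p`
is the last one seen. -/
theorem pivotSearch_spec {N K : ℕ} {s : State} (hn : s.ints .n = N) (hk : s.ints .k = K)
    (hKN : K ≤ N) (hp0 : s.ints .p = 0) (hp : ∃ i, K ≤ i ∧ i ≤ N ∧ s.mem .A i K ≠ 0) :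
    Reach pivotSearch s 1 fun s' =>
      K ≤ s'.ints .p ∧ s'.ints .p ≤ N ∧ s.mem .A (s'.ints .p) K ≠ 0 := by
  refine .mono (Reach.loop (fun m s' => (s'.ints .p = 0 ∧ ∀ i, K ≤ i → i < m → s.mem .A i K = 0) ∨
    (K ≤ s'.ints .p ∧ s'.ints .p < m ∧ s.mem .A (s'.ints .p) K ≠ 0)) ?_ ?_ ?_) ?_
  · simp [hk, hn]; omega
  · left
    simp [hk, hp0]
    intros; omega
  · intro m s1 h1 h2 hI a1
    simp [hk] at h1
    have hA : s1.mem .A = s.mem .A := a1.arr .A rfl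
    have hk1 : s1.ints .k = K := (a1.int .k rfl).trans hk
    refine .ite (fun h => .skip ?_) fun h => .setI ?_
    · simp [hA, hk1] at h
      simp only [State.setI_ints, reduceCtorEq, if_false]
      rcases hI with ⟨h3, h4⟩ | ⟨h3, h4, h5⟩
      · refine Or.inl ⟨h3, fun i hi hi' => ?_⟩
        rcases Nat.lt_succ_iff_lt_or_eq.1 hi' with hlt | rfl
        · exact h4 i hi hlt
        · exact h
      · exact Or.inr ⟨h3, by omega, h5⟩
    · simp [hA, hk1] at h
      right
      simp [h, h1]
  · intro s' h
    simp [hn] at h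
    rcases h with ⟨-, h⟩ | ⟨h1, h2, h3⟩
    · obtain ⟨i, h1, h2, h3⟩ := hp
      exact (h3 (h i h1 (by omega))).elim
    · exact ⟨h1, by omega, h3⟩

theorem eliminate_spec {N K : ℕ} {s : State} (hn : s.ints .n = N) (hk : s.ints .k = K) :
    Reach eliminate s 1 fun s' => ∀ X, X = .A ∨ X = .C → ∀ r c,
      1 ≤ r → r ≤ N → 1 ≤ c → c ≤ N → s'.mem X r c =
        if r = K then s.mem X r c else s.mem X r c - s.mem .A r K * s.mem X K c := by
  refine .mono (Reach.each (N := N) (fun m s' => ∀ X, X = .A ∨ X = .C → ∀ r c, s'.mem X r c =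
    if 1 ≤ r ∧ r < m ∧ r ≠ K ∧ 1 ≤ c ∧ c ≤ N then
      s.mem X r c - s.mem .A r K * s.mem X K c else s.mem X r c) hn ?_ ?_) ?_
  · intro X _ r c
    rw [if_neg (by omega)]
  · intro m s1 h1 h2 hI a1
    have hn1 : s1.ints .n = N := (a1.int .n rfl).trans hn
    have hk1 : s1.ints .k = K := (a1.int .k rfl).trans hk
    refine .ite (fun h => .skip ?_) fun h => .seq (.setR fun _ => ?_)
    · simp [hk1] at h
      intro X hX r c
      rw [State.setI_mem, hI X hX]
      have : (1 ≤ r ∧ r < m + 1 ∧ r ≠ K ∧ 1 ≤ c ∧ c ≤ N) ↔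
        (1 ≤ r ∧ r < m ∧ r ≠ K ∧ 1 ≤ c ∧ c ≤ N) := by omega
      simp only [this]
    · simp [hk1] at h
      -- Row `m` is untouched before pass `m`, so the multiplier read there is still the entry at
      -- loop start.
      have hmK : ¬ (1 ≤ m ∧ m < m ∧ m ≠ K ∧ 1 ≤ K ∧ K ≤ N) := by omega
      refine .seq (.mono (subRow_spec (N := N) .A (by simpa using hn1)) fun s2 h3 a2 => ?_)
      have hx2 : s2.reals .x = s.mem .A m K := by
        rw [a2.real .x rfl]
        simp only [State.setR_reals, if_true, Expr.eval, Ref.eval, State.setI_ints, State.setI_mem,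
          reduceCtorEq, if_false, hk1, hI .A (Or.inl rfl) m K, if_neg hmK]
      have hn2 : s2.ints .n = N := by rw [a2.int .n rfl]; simpa using hn1
      have hk2 : s2.ints .k = K := by rw [a2.int .k rfl]; simpa using hk1
      have hi2 : s2.ints .i = m := by rw [a2.int .i rfl]; simp
      have hC2 : s2.mem .C = s1.mem .C := a2.arr .C rfl
      refine .mono (subRow_spec (N := N) .C hn2).withAgree fun s3 ⟨h4, a3⟩ => ?_
      have hA3 : s3.mem .A = s2.mem .A := a3.arr .A rfl
      have key : ∀ X, X = .A ∨ X = .C → ∀ r c, s3.mem X r c =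
          if r = m ∧ 1 ≤ c ∧ c ≤ N then s1.mem X m c - s.mem .A m K * s1.mem X K c
          else s1.mem X r c := by
        rintro X (rfl | rfl) r c
        · rw [hA3, h3]
          simp only [State.setR_ints, State.setI_ints, reduceCtorEq, if_false, if_true,
            State.setR_reals, State.setI_mem, State.setR_mem, hk1, Expr.eval, Ref.eval]
          rw [hI .A (Or.inl rfl) m K, if_neg hmK]
        · rw [h4, hi2, hk2, hx2, hC2]
      intro X hX r c
      rw [key X hX, hI X hX, hI X hX, hI X hX]
      by_cases hr : r = m
      · subst hr
        split_ifs <;> first | rfl | omega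
      · split_ifs <;> first | rfl | omega
  · intro s' h X hX r c hr1 hr2 hc1 hc2
    rw [h X hX]
    split_ifs <;> first | rfl | omega

/-! ### Elimination steps as matrix operations. -/

/-- The part with indices from `1` of an array. -/
def matOf (N : ℕ) (X : ℕ → ℕ → ℝ) : Matrix (Fin N) (Fin N) ℝ :=
  Matrix.of fun r c => X (r.val + 1) (c.val + 1)

@[simp] theorem matOf_apply {N : ℕ} (X : ℕ → ℕ → ℝ) (r c : Fin N) :
    matOf N X r c = X (r.val + 1) (c.val + 1) := rfl

/-- The effect of the elimination step for the column `k` of `A` with the pivot row `p` on a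
matrix `X` that undergoes the same row operations. -/
noncomputable def gaussStep {N : ℕ} (k p : Fin N) (A X : Matrix (Fin N) (Fin N) ℝ) :
    Matrix (Fin N) (Fin N) ℝ :=
  Matrix.of fun r c =>
    if r = k then X p c / A p k
    else X (if r = p then k else r) c - A (if r = p then k else r) k * (X p c / A p k)

theorem pivotStep_spec {N : ℕ} {s : State} (hn : s.ints .n = N) (k p : Fin N)
    (hk : s.ints .k = k.val + 1) (hp : s.ints .p = p.val + 1)
    (hA : s.mem .A (p.val + 1) (k.val + 1) ≠ 0) :
    Reach pivotStep s 1 fun s' =>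
      matOf N (s'.mem .A) = gaussStep k p (matOf N (s.mem .A)) (matOf N (s.mem .A)) ∧
      matOf N (s'.mem .C) = gaussStep k p (matOf N (s.mem .A)) (matOf N (s.mem .C)) := by
  refine .seq (.ite (fun h => ?_) fun _ => .skip fun _ => ?_)
  · simp [hp] at h
  refine .seq (.mono (swapRows_spec (N := N) .A hn) fun s1 h1 a1 => ?_)
  have hn1 : s1.ints .n = N := (a1.int .n rfl).trans hn
  have hk1 : s1.ints .k = k.val + 1 := (a1.int .k rfl).trans hk
  have hp1 : s1.ints .p = p.val + 1 := (a1.int .p rfl).trans hp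
  have hC1 : s1.mem .C = s.mem .C := a1.arr .C rfl
  refine .seq (.mono (swapRows_spec (N := N) .C hn1) fun s2 h2 a2 => .seq (.setR fun _ => ?_))
  have hn2 : s2.ints .n = N := (a2.int .n rfl).trans hn1
  have hk2 : s2.ints .k = k.val + 1 := (a2.int .k rfl).trans hk1
  have hA2 : s2.mem .A = s1.mem .A := a2.arr .A rfl
  have hx : s2.mem .A (k.val + 1) (k.val + 1) = s.mem .A (p.val + 1) (k.val + 1) := by
    have : 1 ≤ k.val + 1 ∧ k.val + 1 ≤ N := by omega
    rw [hA2, h1, if_pos this, hk, if_pos rfl, hp]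
  refine .seq (.mono (scaleRow_spec (N := N) .A (by simpa using hn2) (by
    simpa [hk2, hx] using hA)) fun s3 h3 a3 => ?_)
  have hn3 : s3.ints .n = N := by rw [a3.int .n rfl]; simpa using hn2
  have hk3 : s3.ints .k = k.val + 1 := by rw [a3.int .k rfl]; simpa using hk2
  have hx3 : s3.reals .x = s.mem .A (p.val + 1) (k.val + 1) := by
    rw [a3.real .x rfl]; simp [hk2, hx]
  have hC3 : s3.mem .C = s2.mem .C := a3.arr .C rfl
  refine .seq (.mono (scaleRow_spec (N := N) .C hn3 (by rwa [hx3])) fun s4 h4 a4 => ?_)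
  have hn4 : s4.ints .n = N := (a4.int .n rfl).trans hn3
  have hk4 : s4.ints .k = k.val + 1 := (a4.int .k rfl).trans hk3
  have hA4 : s4.mem .A = s3.mem .A := a4.arr .A rfl
  have key : ∀ X, X = .A ∨ X = .C → ∀ r c : Fin N, s4.mem X (r.val + 1) (c.val + 1) =
      if r = k then s.mem X (p.val + 1) (c.val + 1) / s.mem .A (p.val + 1) (k.val + 1)
      else s.mem X ((if r = p then k else r).val + 1) (c.val + 1) := by
    have hc : ∀ c : Fin N, 1 ≤ c.val + 1 ∧ c.val + 1 ≤ N := fun c => by omega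
    rintro X (rfl | rfl) r c
    · rw [hA4, h3]
      simp only [State.setR_ints, State.setR_mem, hk2, hc c, and_true, State.setR_reals, if_true,
        Expr.eval, Ref.eval, hx, hA2, h1, hk, hp, Nat.add_right_cancel_iff, ← Fin.ext_iff,
        and_self]
      by_cases hr : r = k
      · simp [hr]
      · simp only [hr, if_false]
        split_ifs <;> rfl
    · rw [h4, hC3, hx3]
      simp only [hk3, hc c, and_true, if_true, h2, hC1, hk1, hp1,
        Nat.add_right_cancel_iff, ← Fin.ext_iff, and_self]
      by_cases hr : r = k
      · simp [hr]
      · simp only [hr, if_false]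
        split_ifs <;> rfl
  refine .mono (eliminate_spec (N := N) hn4 hk4) fun s5 h5 => ?_
  have fin : ∀ X, X = .A ∨ X = .C →
      matOf N (s5.mem X) = gaussStep k p (matOf N (s.mem .A)) (matOf N (s.mem X)) := by
    intro X hX
    ext r c
    rw [matOf_apply, h5 X hX _ _ (by omega) (by omega) (by omega) (by omega), key X hX r c,
      key X hX k c, key .A (Or.inl rfl) r k]
    simp only [Nat.add_right_cancel_iff, ← Fin.ext_iff, gaussStep, Matrix.of_apply, matOf_apply,
      if_true]
    by_cases hr : r = k
    · simp [hr]
    · simp [hr]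
  exact ⟨fin .A (Or.inl rfl), fin .C (Or.inr rfl)⟩

/-- Row operations commute with multiplication on the right; this preserves the invariant `C * L =
A`. -/
theorem gaussStep_mul {N : ℕ} (k p : Fin N) (A X M : Matrix (Fin N) (Fin N) ℝ) :
    gaussStep k p A X * M = gaussStep k p A (X * M) := by
  ext r c
  simp only [gaussStep, Matrix.mul_apply, Matrix.of_apply]
  by_cases hr : r = k
  · simp only [hr, if_true, Finset.sum_div]
    exact Finset.sum_congr rfl fun _ _ => by ring
  · simp only [hr, if_false, Finset.sum_div, Finset.mul_sum, ← Finset.sum_sub_distrib]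
    exact Finset.sum_congr rfl fun _ _ => by ring

/-- The step is invertible: row `k` of the result gives back the pivot row, and then the other rows
are recovered. Trivial kernel is thus an invariant, and no determinant has to be tracked. -/
theorem mulVec_eq_zero_of_gaussStep {N : ℕ} {k p : Fin N} {A : Matrix (Fin N) (Fin N) ℝ}
    (hA : A p k ≠ 0) {v : Fin N → ℝ} (h : (gaussStep k p A A).mulVec v = 0) : A.mulVec v = 0 := by
  have hr : ∀ r, (gaussStep k p A A).mulVec v r =
      if r = k then A.mulVec v p / A p k
      else A.mulVec v (if r = p then k else r) -
        A (if r = p then k else r) k * (A.mulVec v p / A p k) := by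
    intro r
    simp only [gaussStep, Matrix.mulVec, dotProduct, Matrix.of_apply]
    by_cases hr : r = k
    · simp only [hr, if_true, Finset.sum_div]
      exact Finset.sum_congr rfl fun _ _ => by ring
    · simp only [hr, if_false, Finset.sum_div, Finset.mul_sum, ← Finset.sum_sub_distrib]
      exact Finset.sum_congr rfl fun _ _ => by ring
  simp only [h, Pi.zero_apply] at hr
  have hp : A.mulVec v p = 0 := by
    have := hr k
    rw [if_pos rfl] at this
    field_simp at this
    simpa using this.symm
  simp only [hp, zero_div, mul_zero, sub_zero] at hr
  funext r
  by_cases h1 : r = p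
  · rw [h1, hp, Pi.zero_apply]
  by_cases h2 : r = k
  · have := hr p
    rw [if_neg (fun h => h1 (h2.trans h.symm)), if_pos rfl] at this
    rw [h2, ← this, Pi.zero_apply]
  · have := hr r
    rw [if_neg h2, if_neg h1] at this
    rw [← this, Pi.zero_apply]

theorem exists_pivot {N : ℕ} {k : Fin N} {A : Matrix (Fin N) (Fin N) ℝ}
    (hA : ∀ v, A.mulVec v = 0 → v = 0)
    (hcol : ∀ r c : Fin N, c < k → A r c = if r = c then 1 else 0) :
    ∃ p, k ≤ p ∧ A p k ≠ 0 := by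
  by_contra! h
  -- If column `k` vanishes from row `k` on, it is a combination of the earlier unit columns, and
  -- this vector is the resulting kernel element.
  have := hA (fun c => if c = k then 1 else if c < k then - A c k else 0) (by
    funext r
    simp only [Matrix.mulVec, dotProduct, Pi.zero_apply]
    have : ∀ c, A r c * (if c = k then 1 else if c < k then - A c k else 0) =
        (if c = k then A r k else 0) + if c = r then (if r < k then - A r k else 0) else 0 := by
      intro c
      by_cases h1 : c = k
      · subst h1
        by_cases h2 : c = r
        · subst h2; simp
        · simp [h2]
      · by_cases h2 : c < k
        · rw [hcol r c h2]
          by_cases h3 : r = c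
          · subst h3; simp [h1, h2]
          · simp [h1, h2, h3, Ne.symm h3]
        · by_cases h3 : c = r
          · subst h3; simp [h1, h2]
          · simp [h1, h2, h3]
    simp only [this, Finset.sum_add_distrib, Finset.sum_ite_eq', Finset.mem_univ, if_true]
    split_ifs with h1
    · ring
    · rw [h r (not_lt.1 h1), add_zero])
  have := congrFun this k
  simp at this

/-- Since `k ≤ p`, the pivot row is zero in the columns before `k`, so these stay unit columns. -/
theorem gaussStep_col {N : ℕ} {k p : Fin N} {A : Matrix (Fin N) (Fin N) ℝ} (hA : A p k ≠ 0)
    (hkp : k ≤ p) (hcol : ∀ r c : Fin N, c < k → A r c = if r = c then 1 else 0)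
    (r c : Fin N) (hc : c ≤ k) : gaussStep k p A A r c = if r = c then 1 else 0 := by
  rcases hc.lt_or_eq with hc | rfl
  · have hpc : p ≠ c := (hc.trans_le hkp).ne'
    have hkc : k ≠ c := hc.ne'
    simp only [gaussStep, Matrix.of_apply, hcol _ c hc, if_neg hpc, zero_div, mul_zero, sub_zero]
    by_cases h1 : r = k
    · simp [h1, hkc]
    · by_cases h2 : r = p
      · simp [h2, hpc, hkc]
      · simp [h1, h2]
  · simp only [gaussStep, Matrix.of_apply, div_self hA, mul_one, sub_self]

open Prog in
/-- Copy `L` to `A` and store the identity matrix in `C`. -/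
def copyIdentity : Cmd :=
  each .i (.seq (each .c (.seq (.put .A i c (.get .L i c)) (.put .C i c (.lit 0))))
    (.put .C i i (.lit 1)))

theorem copyIdentity_spec {N : ℕ} {s : State} (hn : s.ints .n = N) :
    Reach copyIdentity s 1 fun s' =>
      matOf N (s'.mem .A) = matOf N (s.mem .L) ∧ matOf N (s'.mem .C) = 1 := by
  refine .mono (Reach.each (N := N) (fun m s' => ∀ r c, 1 ≤ r → r < m → 1 ≤ c → c ≤ N →
    s'.mem .A r c = s.mem .L r c ∧ s'.mem .C r c = if r = c then 1 else 0) hn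
    (by intros; omega) ?_) ?_
  · intro m s1 h1 h2 hI a1
    have hn1 : s1.ints .n = N := (a1.int .n rfl).trans hn
    have hL1 : s1.mem .L = s.mem .L := a1.arr .L rfl
    refine .seq (.mono (Reach.each (N := N) (fun l s' =>
      (∀ r c, r ≠ m → s'.mem .A r c = s1.mem .A r c ∧ s'.mem .C r c = s1.mem .C r c) ∧
      ∀ c, 1 ≤ c → c < l → s'.mem .A m c = s.mem .L m c ∧ s'.mem .C m c = 0) (by simpa using hn1)
      ⟨by simp, by intros; omega⟩ ?_) ?_)
    · intro l s2 h3 h4 ⟨hI1, hI2⟩ a2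
      have hi : s2.ints .i = m := by rw [a2.int .i rfl]; simp
      have hL2 : s2.mem .L = s.mem .L := (a2.arr .L rfl).trans hL1
      refine .seq (.put fun _ => .put ⟨fun r c hr => ?_, fun c hc1 hc2 => ?_⟩)
      · simp [hi, hr, hI1 r c hr]
      · by_cases hc : c = l
        · subst hc; simp [hi, hL2]
        · have := hI2 c hc1 (by omega)
          simp [hi, hc, this]
    · intro s2 ⟨h3, h4⟩ a2
      have hi : s2.ints .i = m := by rw [a2.int .i rfl]; simp
      refine .put fun r c hr1 hr2 hc1 hc2 => ?_
      by_cases hr : r = m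
      · subst hr
        by_cases hc : c = r
        · subst hc; simp [hi, h4 c hc1 (by omega)]
        · simp [hi, hc, Ne.symm hc, h4 c hc1 (by omega)]
      · have := hI r c hr1 (by omega) hc1 hc2
        simp [hi, hr, h3 r c hr, this]
  · intro s' h
    refine ⟨?_, ?_⟩
    · ext r c
      exact (h _ _ (by omega) (by omega) (by omega) (by omega)).1
    · ext r c
      rw [matOf_apply, (h _ _ (by omega) (by omega) (by omega) (by omega)).2, Matrix.one_apply]
      simp [Fin.ext_iff]

/-- Invariant: `C * L = A`, the kernel of `A` is trivial, and the processed columns of `A` are unit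
columns. A trivial kernel supplies the next pivot; at the end `A = 1`, so `C` is the inverse. -/
theorem inverseTranspose_spec {N : ℕ} {s : State} (hn : s.ints .n = N)
    (hL : (matOf N (s.mem .L)).det ≠ 0) :
    Reach Prog.inverseTranspose s 1 fun s' =>
      matOf N (s'.mem .B) = ((matOf N (s.mem .L))⁻¹).transpose := by
  refine .seq (.mono (copyIdentity_spec hn) fun s1 ⟨hA1, hC1⟩ a1 => ?_)
  have hn1 : s1.ints .n = N := (a1.int .n rfl).trans hn
  set M := matOf N (s.mem .L) with hM
  refine .seq (.mono (Reach.each (N := N) (fun m s' =>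
    matOf N (s'.mem .C) * M = matOf N (s'.mem .A) ∧
    (∀ v, (matOf N (s'.mem .A)).mulVec v = 0 → v = 0) ∧
    ∀ r c : Fin N, c.val + 1 < m → matOf N (s'.mem .A) r c = if r = c then 1 else 0) hn1 ?_ ?_) ?_)
  · refine ⟨by rw [hC1, hA1, one_mul], fun v hv => ?_, by intros; omega⟩
    rw [hA1] at hv
    exact Matrix.eq_zero_of_mulVec_eq_zero hL hv
  · intro m s2 h1 h2 ⟨hI1, hI2, hI3⟩ a2
    obtain ⟨K, rfl⟩ : ∃ K, m = K + 1 := ⟨m - 1, by omega⟩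
    let k : Fin N := ⟨K, by omega⟩
    have hn2 : s2.ints .n = N := (a2.int .n rfl).trans hn1
    have hcol : ∀ r c : Fin N, c < k → matOf N (s2.mem .A) r c = if r = c then 1 else 0 :=
      fun r c hc => hI3 r c (Nat.succ_lt_succ hc)
    obtain ⟨p₀, hkp, hp₀⟩ := exists_pivot hI2 hcol
    refine .seq (.setI fun _ => .seq (.mono (pivotSearch_spec (N := N) (K := K + 1)
      (by simpa using hn2) (by simp) h2 (by simp)
      ⟨p₀.val + 1, Nat.succ_le_succ hkp, by omega, hp₀⟩) fun s3 ⟨h3, h4, h5⟩ a3 => ?_))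
    obtain ⟨P, hP⟩ : ∃ P, s3.ints .p = P + 1 := ⟨s3.ints .p - 1, by omega⟩
    let p : Fin N := ⟨P, by omega⟩
    have hn3 : s3.ints .n = N := by rw [a3.int .n rfl]; simpa using hn2
    have hk3 : s3.ints .k = k.val + 1 := by rw [a3.int .k rfl]; simp [k]
    have hA3 : s3.mem .A = s2.mem .A := a3.arr .A rfl
    have hC3 : s3.mem .C = s2.mem .C := a3.arr .C rfl
    have hpk : matOf N (s2.mem .A) p k ≠ 0 := by
      rw [hP] at h5
      exact h5
    refine .mono (pivotStep_spec (N := N) hn3 k p hk3 hP (by rw [hA3]; exact hpk)) ?_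
    intro s4 ⟨h6, h7⟩
    rw [hA3] at h6 h7
    rw [hC3] at h7
    rw [h6, h7]
    refine ⟨by rw [gaussStep_mul, hI1], fun v hv => hI2 v (mulVec_eq_zero_of_gaussStep hpk hv), ?_⟩
    exact fun r c hc => gaussStep_col hpk (Fin.mk_le_mk.2 (by omega)) hcol r c
      (Fin.le_def.2 (by simp only [k]; omega))
  · intro s2 ⟨h1, _, h3⟩ a2
    have hn2 : s2.ints .n = N := (a2.int .n rfl).trans hn1
    have hone : matOf N (s2.mem .A) = 1 := by
      ext r c
      rw [h3 r c (by omega), Matrix.one_apply]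
    rw [hone] at h1
    rw [Matrix.inv_eq_left_inv h1]
    refine .mono (Reach.each_rows .B (fun r c => s2.mem .C c r) hn2 ?_) fun s3 h => ?_
    · intro m s3 h4 h5 a3 hI
      have hn3 : s3.ints .n = N := (a3.int .n rfl).trans hn2
      refine Reach.mono (Reach.each_row .B m (fun c => s2.mem .C c m) (by simpa using hn3) ?_)
        fun s4 h r c => ?_
      · intro l s4 h6 h7 a4 hI4
        have hi4 : s4.ints .i = m := by rw [a4.int .i rfl]; simp
        have hC4 : s4.mem .C = s2.mem .C := (a4.arr .C rfl).trans (a3.arr .C rfl)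
        refine .put fun r c => ?_
        simp [hi4, hC4]
      · rw [h]
        by_cases hr : r = m
        · subst hr; simp
        · simp [hr]
    · ext r c
      have h1 : 1 ≤ r.val + 1 ∧ r.val + 1 ≤ N ∧ 1 ≤ c.val + 1 ∧ c.val + 1 ≤ N := by omega
      rw [matOf_apply, h, if_pos h1, Matrix.transpose_apply, matOf_apply]

theorem Reach.seq_right {c d : Cmd} {s : State} {p : ENNReal} {Q : State → Prop}
    (h : Reach c s p fun s' => AgreeOff c.writes s s' → Reach d s' 1 Q) :
    Reach (.seq c d) s p Q := mul_one p ▸ Reach.seq_mul h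

theorem sum_Ico_one_succ {N : ℕ} (g : ℕ → ℝ) :
    ∑ i ∈ Finset.Ico 1 (N + 1), g i = ∑ i : Fin N, g (i.val + 1) := by
  rw [Finset.sum_Ico_eq_sum_range, Fin.sum_univ_eq_sum_range (fun i => g (i + 1))]
  simp [add_comm]

/-- The array `W` holds the weights of the graph. -/
def HoldsWeights {N : ℕ} (G : Graph N) (W : ℕ → ℕ → ℝ) : Prop :=
  ∀ a b : Fin (N + 1), W a.val b.val = G.w a b

theorem natLaplacian_eq {N : ℕ} {G : Graph N} {W : ℕ → ℕ → ℝ} (hW : HoldsWeights G W)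
    (i j : Fin N) : natLaplacian N W (i.val + 1) (j.val + 1) = G.laplacian i j := by
  have h1 : W 0 (j.val + 1) = G.w 0 j.succ := hW 0 j.succ
  have h2 : ∀ k : Fin N, W (k.val + 1) (j.val + 1) = G.w k.succ j.succ := fun k => hW k.succ j.succ
  rw [natLaplacian, Graph.laplacian, sum_Ico_one_succ, h1, h2, Finset.sum_filter]
  simp only [Nat.add_eq_right, Nat.add_right_cancel_iff, ← Fin.ext_iff, h2]
  split_ifs with h3 h4
  · rfl
  · subst h4
    exact Finset.sum_congr rfl fun k _ => by by_cases h : k = i <;> simp [h]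
  · rfl

/-! ## Sampling an edge -/

/-- With its companion for non-root parents, this rewrites the Cramer pairing as the expression that
the program evaluates in constant time. -/
theorem dotProduct_edgeColumn_zero {N : ℕ} (G : Graph N) (j : Fin N) (b : Fin N → ℝ) :
    b ⬝ᵥ G.edgeColumn 0 j = G.w 0 j.succ * b ⟨0, j.pos⟩ := by
  rw [dotProduct, Finset.sum_eq_single ⟨0, j.pos⟩]
  · simp [Graph.edgeColumn, mul_comm]
  · intro k _ hk
    have : k.val ≠ 0 := fun h => hk (Fin.ext h)
    simp [Graph.edgeColumn, this]
  · simp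

theorem dotProduct_edgeColumn_succ {N : ℕ} (G : Graph N) (i j : Fin N) (b : Fin N → ℝ) :
    b ⬝ᵥ G.edgeColumn i.succ j =
      G.w i.succ j.succ * ((if j.val = 0 then 0 else b j) - (if i.val = 0 then 0 else b i)) := by
  simp only [dotProduct, Graph.edgeColumn, Fin.succ_ne_zero, if_false, Fin.val_succ,
    Fin.succ_inj, Nat.add_eq_right, ne_eq]
  have : ∀ k, b k * (G.w i.succ j.succ * ((if ¬j.val = 0 ∧ k = j then 1 else 0) -
      (if ¬i.val = 0 ∧ k = i then 1 else 0))) = G.w i.succ j.succ *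
      ((if k = j then (if j.val = 0 then 0 else b j) else 0) -
        (if k = i then (if i.val = 0 then 0 else b i) else 0)) := by
    intro k
    rw [mul_left_comm, mul_sub]
    congr 2
    · by_cases h : k = j
      · subst h; by_cases h' : k.val = 0 <;> simp [h']
      · simp [h]
    · by_cases h : k = i
      · subst h; by_cases h' : k.val = 0 <;> simp [h']
      · simp [h]
  simp only [this, ← Finset.mul_sum, Finset.sum_sub_distrib, Finset.sum_ite_eq', Finset.mem_univ,
    if_true]

theorem sampleEdge_spec {N : ℕ} {s : State} {G : Graph N} {j : Fin N} (e : Fin (N + 1))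
    (hn : s.ints .n = N) (hj : s.ints .j = j.val + 1) (hW : HoldsWeights G (s.mem .W))
    (h0 : ∀ i, 0 ≤ (fun k => matOf N (s.mem .B) k j) ⬝ᵥ G.edgeColumn i j)
    (h1 : ∑ i, (fun k => matOf N (s.mem .B) k j) ⬝ᵥ G.edgeColumn i j = 1) :
    Reach Prog.sampleEdge s
      (ENNReal.ofReal ((fun k => matOf N (s.mem .B) k j) ⬝ᵥ G.edgeColumn e j))
      fun s' => s'.ints .e = e.val := by
  refine .seq (.put fun _ => ?_)
  set b : Fin N → ℝ := fun k => matOf N (s.mem .B) k j with hb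
  set s0 := s.put .M (Ref.eval s Prog.zero) (Ref.eval s Prog.zero)
    (Expr.eval s (.mul (.get .W Prog.zero Prog.j) (.get .B Prog.one Prog.j))) with hs0
  set F : ℕ → ℝ := fun i => if i = j.val + 1 then 0 else s.mem .W i (j.val + 1) *
    ((if j.val + 1 = 1 then 0 else s.mem .B (j.val + 1) (j.val + 1)) -
      (if i = 1 then 0 else s.mem .B i (j.val + 1))) with hF
  refine .seq (.mono (Reach.each_row .M 0 F hn ?_) fun s1 h2 a1 => ?_)
  · intro m s1 hm1 hm2 a1 hI
    have hj1 : s1.ints .j = j.val + 1 := (a1.int .j rfl).trans hj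
    have hB1 : s1.mem .B = s.mem .B := (a1.arr .B rfl).trans (by funext r c; simp [hs0])
    have hW1 : s1.mem .W = s.mem .W := (a1.arr .W rfl).trans (by funext r c; simp [hs0])
    refine .ite (fun h => .put ?_) fun h => .seq (.setR fun _ => ?_)
    · simp [hj1] at h
      intro r c
      simp [hF, h]
    · simp [hj1] at h
      refine .seq (.mono (R := fun s' => s'.reals .x =
        if j.val + 1 = 1 then 0 else s.mem .B (j.val + 1) (j.val + 1)) (.ite (fun h' => .skip ?_)
        fun h' => .setR ?_) fun s2 h3 a2 => ?_)
      · simp [hj1] at h'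
        simp [h']
      · simp [hj1] at h'
        simp [h', hj1, hB1]
      have hj2 : s2.ints .j = j.val + 1 := by rw [a2.int .j rfl]; simpa using hj1
      have hi2 : s2.ints .i = m := by rw [a2.int .i rfl]; simp
      have hB2 : s2.mem .B = s.mem .B := (a2.arr .B rfl).trans hB1
      have hW2 : s2.mem .W = s.mem .W := (a2.arr .W rfl).trans hW1
      have hM2 : s2.mem .M = s1.mem .M := a2.arr .M rfl
      refine .seq (.mono (R := fun s' => s'.reals .x =
        (if j.val + 1 = 1 then 0 else s.mem .B (j.val + 1) (j.val + 1)) -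
          (if m = 1 then 0 else s.mem .B m (j.val + 1))) (.ite (fun h' => .skip ?_)
        fun h' => .setR ?_) fun s3 h4 a3 => .put ?_)
      · simp [hi2] at h'
        simp [h', h3]
      · simp [hi2] at h'
        simp [h', h3, hi2, hj2, hB2]
      have hj3 : s3.ints .j = j.val + 1 := (a3.int .j rfl).trans hj2
      have hi3 : s3.ints .i = m := (a3.int .i rfl).trans hi2
      have hW3 : s3.mem .W = s.mem .W := (a3.arr .W rfl).trans hW2
      have hM3 : s3.mem .M = s1.mem .M := (a3.arr .M rfl).trans hM2
      intro r c
      simp only [State.put_mem, Ref.eval, Expr.eval, hi3, hj3, hW3, hM3, h4, hF, if_neg h,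
        true_and]
  · have hn1 : s1.ints .n = N := (a1.int .n rfl).trans hn
    have hM : ∀ i : Fin (N + 1), s1.mem .M 0 i.val = b ⬝ᵥ G.edgeColumn i j := by
      intro i
      rw [h2]
      induction i using Fin.cases with
      | zero =>
        rw [dotProduct_edgeColumn_zero, ← hW]
        simp [hs0, hj, hb]
      | succ i =>
        have hi : 1 ≤ i.val + 1 ∧ i.val + 1 ≤ N := by omega
        have hw : s.mem .W (i.val + 1) (j.val + 1) = G.w i.succ j.succ := hW i.succ j.succ
        rw [Fin.val_succ, if_pos ⟨rfl, hi⟩, dotProduct_edgeColumn_succ, hF]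
        simp only [hw, Nat.add_right_cancel_iff, Nat.add_eq_right]
        -- For a self-loop the two terms cancel, in agreement with the 0 stored by the program.
        by_cases hij : i.val = j.val
        · simp [Fin.ext hij]
        · simp [hij, hb]
    have hp : IsProbVec (s1.mem .M 0) (Ref.eval s1 Prog.n) := by
      simp only [Ref.eval, hn1]
      refine ⟨fun k hk => ?_, ?_⟩
      · rw [hM ⟨k, Finset.mem_range.1 hk⟩]
        exact h0 _
      · rw [← Fin.sum_univ_eq_sum_range (fun k => s1.mem .M 0 k), ← h1]
        exact Finset.sum_congr rfl fun i _ => hM i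
    rw [← hM e]
    refine .sample hp ?_ (by simp)
    simp only [Ref.eval, hn1]
    omega

/-! ## Conditioning -/

theorem condition_spec {N : ℕ} {s : State} {G : Graph N} {j : Fin N} {e : Fin (N + 1)}
    {u : Fin N → ℝ} {A B : Matrix (Fin N) (Fin N) ℝ} (hn : s.ints .n = N)
    (hj : s.ints .j = j.val + 1) (he : s.ints .e = e.val) (hW : HoldsWeights G (s.mem .W))
    (hA : matOf N (s.mem .L) = A) (hB : matOf N (s.mem .B) = B)
    (hu : u = G.edgeColumn e j - fun k => A k j)
    (h0 : 1 + u ⬝ᵥ (fun k => B k j) ≠ 0) :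
    Reach Prog.condition s 1 fun s' =>
      matOf N (s'.mem .L) = A.updateCol j (G.edgeColumn e j) ∧
      matOf N (s'.mem .B) = B - (1 / (1 + u ⬝ᵥ (fun k => B k j))) •
        Matrix.vecMulVec (fun k => B k j) (Matrix.vecMul u B) := by
  have hLe : ∀ r c : Fin N, s.mem .L (r.val + 1) (c.val + 1) = A r c := fun r c => by
    rw [← hA, matOf_apply]
  have hBe : ∀ r c : Fin N, s.mem .B (r.val + 1) (c.val + 1) = B r c := fun r c => by
    rw [← hB, matOf_apply]
  have hWe : s.mem .W e.val (j.val + 1) = G.w e j.succ := hW e j.succ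
  -- the vector `u`
  refine .seq (.mono (Reach.each_row .U 0 (fun i => 0 - s.mem .L i (j.val + 1)) hn ?_)
    fun s1 h1 a1 => ?_)
  · intro m s1 _ _ a1 _
    have hj1 : s1.ints .j = j.val + 1 := (a1.int .j rfl).trans hj
    have hL1 : s1.mem .L = s.mem .L := a1.arr .L rfl
    refine .put fun r c => ?_
    simp [hj1, hL1]
  have hn1 : s1.ints .n = N := (a1.int .n rfl).trans hn
  have hj1 : s1.ints .j = j.val + 1 := (a1.int .j rfl).trans hj
  have he1 : s1.ints .e = e.val := (a1.int .e rfl).trans he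
  have hL1 : s1.mem .L = s.mem .L := a1.arr .L rfl
  have hB1 : s1.mem .B = s.mem .B := a1.arr .B rfl
  have hW1 : s1.mem .W = s.mem .W := a1.arr .W rfl
  have hU1 : ∀ k : Fin N, s1.mem .U 0 (k.val + 1) = - A k j := by
    intro k
    have : 1 ≤ k.val + 1 ∧ k.val + 1 ≤ N := by omega
    rw [h1, if_pos ⟨rfl, this⟩, hLe, zero_sub]
  refine .seq (.mono (R := fun s' => ∀ k : Fin N, s'.mem .U 0 (k.val + 1) = u k)
    (.ite (fun h => .put fun k => ?_) fun h => ?_) fun s2 hU2 a2 => ?_)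
  · have he0 : e = 0 := Fin.ext (by simpa [he1] using h)
    have hw0 : s.mem .W 0 (j.val + 1) = G.w 0 j.succ := hW 0 j.succ
    by_cases hk : k.val = 0
    · have h1U := hU1 k
      rw [hk] at h1U
      simp [hu, he0, Graph.edgeColumn, hk, hj1, hW1, hw0, h1U]
      ring
    · simp [hu, he0, Graph.edgeColumn, hk, hU1]
  · have he0 : e ≠ 0 := fun he0 => by simp [he1, he0] at h
    -- The two corrections are handled one after the other, because for `e = j + 1` both hit the
    -- same entry and cancel.
    refine .seq (.mono (R := fun s' => ∀ k : Fin N, s'.mem .U 0 (k.val + 1) =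
      - A k j + G.w e j.succ * (if j.val ≠ 0 ∧ k = j then 1 else 0))
      (.ite (fun h => .skip fun k => ?_) fun h => .put fun k => ?_) fun s2 hU2 a2 => ?_)
    · simp [hj1] at h
      simp [h, hU1]
    · simp [hj1] at h
      by_cases hk : k = j
      · subst hk
        simp [h, hU1, hj1, he1, hW1, hWe]
      · have : k.val ≠ j.val := fun h => hk (Fin.ext h)
        simp [hk, this, hU1, hj1]
    · have hj2 : s2.ints .j = j.val + 1 := (a2.int .j rfl).trans hj1
      have he2 : s2.ints .e = e.val := (a2.int .e rfl).trans he1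
      have hW2 : s2.mem .W = s.mem .W := (a2.arr .W rfl).trans hW1
      have huk : ∀ k, u k = - A k j + G.w e j.succ * (if j.val ≠ 0 ∧ k = j then 1 else 0) -
          G.w e j.succ * (if e.val ≠ 1 ∧ k.succ = e then 1 else 0) := by
        intro k
        rw [hu, Pi.sub_apply, Graph.edgeColumn, if_neg he0]
        ring
      refine .ite (fun h => .skip fun k => ?_) fun h => .put fun k => ?_
      · simp [he2] at h
        rw [huk, hU2, h]
        simp
      · simp [he2] at h
        rw [huk, State.put_mem]
        by_cases hk : k.succ = e
        · have hke : e.val = k.val + 1 := by rw [← hk, Fin.val_succ]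
          simp only [Ref.eval, Expr.eval, he2, hj2, hW2, hWe, true_and, if_pos hke.symm]
          rw [hke, hU2]
          rw [hke] at h
          simp only [ne_eq, h, not_false_eq_true, hk, and_self, if_true, mul_one]
        · have : ¬ k.val + 1 = e.val := fun h => hk (Fin.ext h)
          simp only [Ref.eval, he2, this, and_false, if_false, hU2, hk]
          simp
  have hn2 : s2.ints .n = N := (a2.int .n rfl).trans hn1
  have hj2 : s2.ints .j = j.val + 1 := (a2.int .j rfl).trans hj1
  have hL2 : s2.mem .L = s.mem .L := (a2.arr .L rfl).trans hL1
  have hB2 : s2.mem .B = s.mem .B := (a2.arr .B rfl).trans hB1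
  -- the Laplacian
  refine .seq (.mono (Reach.each (N := N) (fun m s' => ∀ r c, s'.mem .L r c =
    if c = j.val + 1 ∧ 1 ≤ r ∧ r < m then s.mem .L r c + s2.mem .U 0 r else s.mem .L r c) hn2
    ?_ ?_) fun s3 h3 a3 => ?_)
  · intro r c
    rw [if_neg (by omega), hL2]
  · intro m s3 hm1 hm2 hI a3
    have hj3 : s3.ints .j = j.val + 1 := (a3.int .j rfl).trans hj2
    have hU3 : s3.mem .U = s2.mem .U := a3.arr .U rfl
    refine .put fun r c => ?_
    simp only [State.put_mem, Ref.eval, Expr.eval, State.setI_ints, State.setI_mem, if_true,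
      reduceCtorEq, if_false, hj3, hU3, hI, true_and]
    by_cases hr : r = m
    · subst hr
      by_cases hc : c = j.val + 1
      · subst hc; simp [hm1]
      · simp [hc]
    · have : (1 ≤ r ∧ r < m + 1) ↔ (1 ≤ r ∧ r < m) := by omega
      simp only [hr, this, false_and, if_false]
  have hn3 : s3.ints .n = N := (a3.int .n rfl).trans hn2
  have hj3 : s3.ints .j = j.val + 1 := (a3.int .j rfl).trans hj2
  have hU3 : s3.mem .U = s2.mem .U := a3.arr .U rfl
  have hB3 : s3.mem .B = s.mem .B := (a3.arr .B rfl).trans hB2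
  -- the row vector `uᵀ B`
  refine .seq (.mono (Reach.each_row .V 0
    (fun k => ∑ i ∈ Finset.Ico 1 (N + 1), s2.mem .U 0 i * s.mem .B i k) hn3 ?_) fun s4 h4 a4 => ?_)
  · intro m s4 _ _ a4 _
    refine .seq (.put fun _ => ?_)
    refine .mono (Reach.each (N := N) (fun l s' => ∀ r c, s'.mem .V r c =
      if r = 0 ∧ c = m then ∑ i ∈ Finset.Ico 1 l, s2.mem .U 0 i * s.mem .B i m
      else s4.mem .V r c) ?_ ?_ ?_) fun s5 h => h
    · simpa [hn3] using a4.int .n rfl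
    · intro r c
      simp
    · intro l s5 hl1 hl2 hI a5
      have hk5 : s5.ints .k = m := by rw [a5.int .k rfl]; simp
      have hU5 : s5.mem .U 0 l = s2.mem .U 0 l := by
        rw [a5.arr .U rfl, ← hU3, ← a4.arr .U rfl]; simp
      have hB5 : s5.mem .B l m = s.mem .B l m := by
        rw [a5.arr .B rfl, ← hB3, ← a4.arr .B rfl]; simp
      refine .put fun r c => ?_
      simp only [State.put_mem, Ref.eval, Expr.eval, State.setI_ints, State.setI_mem, if_true,
        reduceCtorEq, if_false, hk5, hU5, hB5, hI, true_and, and_self,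
        Finset.sum_Ico_succ_top hl1]
      split_ifs <;> rfl
  have hn4 : s4.ints .n = N := (a4.int .n rfl).trans hn3
  have hj4 : s4.ints .j = j.val + 1 := (a4.int .j rfl).trans hj3
  have hU4 : s4.mem .U = s2.mem .U := (a4.arr .U rfl).trans hU3
  have hB4 : s4.mem .B = s.mem .B := (a4.arr .B rfl).trans hB3
  have hL4 : s4.mem .L = s3.mem .L := a4.arr .L rfl
  have hV4 : ∀ k : Fin N, s4.mem .V 0 (k.val + 1) = Matrix.vecMul u B k := by
    intro k
    have : 1 ≤ k.val + 1 ∧ k.val + 1 ≤ N := by omega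
    rw [h4, if_pos ⟨rfl, this⟩, sum_Ico_one_succ, Matrix.vecMul, dotProduct]
    exact Finset.sum_congr rfl fun i _ => by rw [hU2, hBe]
  -- the denominator
  refine .seq (.setR fun _ => .seq (.mono (Reach.each (N := N) (fun l s' => s'.reals .x =
    1 + ∑ i ∈ Finset.Ico 1 l, s2.mem .U 0 i * s.mem .B i (j.val + 1)) (by simpa using hn4)
    (by simp) ?_) fun s5 hx5 a5 => ?_))
  · intro l s5 hl1 hl2 hI a5
    have hj5 : s5.ints .j = j.val + 1 := (a5.int .j rfl).trans hj4
    have hU5 : s5.mem .U = s2.mem .U := (a5.arr .U rfl).trans hU4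
    have hB5 : s5.mem .B = s.mem .B := (a5.arr .B rfl).trans hB4
    refine .setR ?_
    simp [hI, hj5, hU5, hB5, Finset.sum_Ico_succ_top hl1]
    ring
  have hn5 : s5.ints .n = N := (a5.int .n rfl).trans hn4
  have hj5 : s5.ints .j = j.val + 1 := (a5.int .j rfl).trans hj4
  have hB5 : s5.mem .B = s.mem .B := (a5.arr .B rfl).trans hB4
  have hV5 : s5.mem .V = s4.mem .V := a5.arr .V rfl
  have hL5 : s5.mem .L = s3.mem .L := (a5.arr .L rfl).trans hL4
  set α := 1 + u ⬝ᵥ (fun k => B k j) with hα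
  have hxα : s5.reals .x = α := by
    rw [hx5, sum_Ico_one_succ, hα, dotProduct]
    congr 1
    exact Finset.sum_congr rfl fun i _ => by rw [hU2, hBe]
  -- the quotients
  refine .seq (.mono (Reach.each_row .Q 0 (fun i => s.mem .B i (j.val + 1) / α) hn5 ?_)
    fun s6 h6 a6 => ?_)
  · intro m s6 _ _ a6 _
    have hj6 : s6.ints .j = j.val + 1 := (a6.int .j rfl).trans hj5
    have hB6 : s6.mem .B = s.mem .B := (a6.arr .B rfl).trans hB5
    have hx6 : s6.reals .x = α := (a6.real .x rfl).trans hxα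
    refine .seq (.div (by simpa [hx6] using h0) fun _ => .put fun r c => ?_)
    simp [hj6, hB6, hx6]
  have hn6 : s6.ints .n = N := (a6.int .n rfl).trans hn5
  have hB6 : s6.mem .B = s.mem .B := (a6.arr .B rfl).trans hB5
  have hV6 : s6.mem .V = s4.mem .V := (a6.arr .V rfl).trans hV5
  have hL6 : s6.mem .L = s3.mem .L := (a6.arr .L rfl).trans hL5
  -- the transposed inverse
  refine .mono (Reach.each_rows .B
    (fun r c => s.mem .B r c - s6.mem .Q 0 r * s4.mem .V 0 c) hn6 ?_).withAgree
    fun s7 ⟨h7, a7⟩ => ⟨?_, ?_⟩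
  · intro m s7 hm1 hm2 a7 hI
    have hn7 : s7.ints .n = N := (a7.int .n rfl).trans hn6
    have hQ7 : s7.mem .Q = s6.mem .Q := a7.arr .Q rfl
    have hV7 : s7.mem .V = s4.mem .V := (a7.arr .V rfl).trans hV6
    refine .mono (Reach.each_row .B m (fun c => s.mem .B m c - s6.mem .Q 0 m * s4.mem .V 0 c)
      (by simpa using hn7) ?_) fun s8 h r c => ?_
    · intro l s8 _ _ a8 hI8
      have hi8 : s8.ints .i = m := by rw [a8.int .i rfl]; simp
      have hQ8 : s8.mem .Q = s6.mem .Q := (a8.arr .Q rfl).trans hQ7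
      have hV8 : s8.mem .V = s4.mem .V := (a8.arr .V rfl).trans hV7
      -- Updating `B` in place is safe: each entry is read once, just before it is overwritten, and
      -- `Q` and `V` were computed from the old `B`.
      have hB8 : s8.mem .B m l = s.mem .B m l := by
        rw [hI8, if_neg (by omega), State.setI_mem, hI, if_neg (by omega), hB6]
      refine .put fun r c => ?_
      simp [hi8, hQ8, hV8, hB8]
    · rw [h]
      by_cases hr : r = m
      · subst hr; simp
      · simp [hr]
  · ext r c
    have hr : 1 ≤ r.val + 1 ∧ r.val + 1 < N + 1 := by omega
    rw [matOf_apply, a7.arr .L rfl, hL6, h3, hU2, hLe, Matrix.updateCol_apply]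
    simp only [hr, and_true, Nat.add_right_cancel_iff, ← Fin.ext_iff, and_self]
    by_cases hc : c = j
    · subst hc
      simp [hu]
    · simp [hc]
  · ext r c
    have hr : 1 ≤ r.val + 1 ∧ r.val + 1 ≤ N := by omega
    have hrc : 1 ≤ r.val + 1 ∧ r.val + 1 ≤ N ∧ 1 ≤ c.val + 1 ∧ c.val + 1 ≤ N := by omega
    rw [matOf_apply, h7, if_pos hrc, h6, if_pos ⟨rfl, hr⟩, hV4, hBe, hBe, Matrix.sub_apply,
      Matrix.smul_apply, Matrix.vecMulVec_apply, smul_eq_mul]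
    ring

/-! ## The sampler -/

theorem prod_div_telescope {Z : ℕ → ℝ} (h : ∀ m, Z m ≠ 0) (N : ℕ) :
    ∏ m ∈ Finset.Ico 1 (N + 1), Z m / Z (m - 1) = Z N / Z 0 := by
  induction N with
  | zero => simp [div_self (h 0)]
  | succ N ih =>
    rw [Finset.prod_Ico_succ_top (by omega), ih, Nat.add_sub_cancel, div_mul_div_comm,
      mul_comm, mul_div_mul_right _ _ (h N)]

-- Follows the path on which every node draws its parent under `f`; all `Z m` being non-zero rules
-- out failure along it.
open DepSampling.Graph in
theorem colbourn_spec {N : ℕ} (hN : 1 ≤ N) {G : Graph N} {f : Fin N → Fin (N + 1)}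
    (hZ : ∀ m, (G.restrict f m).partition ≠ 0) :
    Reach Prog.colbourn (initState G)
      (ENNReal.ofReal ((G.restrict f N).partition / G.partition))
      fun s => s.out.toFinset = edgeCode (parentEdges f) := by
  have hW : HoldsWeights G ((initState G).mem .W) := by
    intro a b
    simp only [initState, if_true]
    rw [dif_pos ⟨a.isLt, b.isLt⟩]
  refine .seq (.mono (laplacian_spec (N := N) rfl (by simp [initState])) fun s1 h1 a1 => ?_)
  have hn1 : s1.ints .n = N := a1.int .n rfl
  have hW1 : HoldsWeights G (s1.mem .W) := by rwa [a1.arr .W rfl]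
  have hL1 : matOf N (s1.mem .L) = G.laplacian := by
    ext r c
    rw [matOf_apply, h1 _ _ (by omega) (by omega) (by omega) (by omega), natLaplacian_eq hW]
  have hG : G.partition ≠ 0 := by simpa [restrict_zero] using hZ 0
  refine .seq (.mono (inverseTranspose_spec hn1 (by
    rw [hL1]; exact det_laplacian_ne_zero hN hG)) fun s2 h2 a2 => ?_)
  have hn2 : s2.ints .n = N := (a2.int .n rfl).trans hn1
  have hW2 : HoldsWeights G (s2.mem .W) := by rwa [a2.arr .W rfl]
  have hL2 : matOf N (s2.mem .L) = G.laplacian := by rw [a2.arr .L rfl, hL1]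
  rw [hL1] at h2
  have ho2 : s2.out = [] := (a2.out rfl).trans ((a1.out rfl).trans rfl)
  let Z : ℕ → ℝ := fun m => (G.restrict f m).partition
  have hloop := Reach.loop_prod (c := .seq Prog.sampleEdge (.seq (.emit Prog.e Prog.j)
    Prog.condition)) (s := s2) (v := .j) (lo := Prog.one) (hi := Prog.n)
    (P := fun m => ENNReal.ofReal (Z m / Z (m - 1)))
    -- The loop register starts at 1, so before the pass with value `m` exactly the nodes `1, …, m -
    -- 1` have been fixed.
    (fun m s' => matOf N (s'.mem .L) = (G.restrict f (m - 1)).laplacian ∧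
      matOf N (s'.mem .B) = ((G.restrict f (m - 1)).laplacian⁻¹).transpose ∧
      ∀ x, x ∈ s'.out ↔ ∃ k : Fin N, k.val + 1 < m ∧ x = ((f k).val, k.val + 1))
    (by simp) ?_ ?_
  · simp only [Ref.eval, hn2] at hloop
    rw [← ENNReal.ofReal_prod_of_nonneg (fun m _ => div_nonneg (partition_nonneg _)
      (partition_nonneg _)), prod_div_telescope hZ] at hloop
    simp only [restrict_zero] at hloop
    refine .mono hloop fun s3 ⟨_, _, h3⟩ => ?_
    ext x
    rw [List.mem_toFinset, h3]
    simp only [edgeCode, parentEdges, Finset.mem_image, Finset.mem_univ, true_and,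
      exists_exists_eq_and]
    exact ⟨fun ⟨k, _, hk⟩ => ⟨k, hk.symm⟩, fun ⟨k, hk⟩ => ⟨k, by omega, hk.symm⟩⟩
  · simp only [Ref.eval, Nat.sub_self, restrict_zero]
    exact ⟨hL2, h2, fun x => by simp [ho2]⟩
  · intro m s3 hm1 hm2 ⟨hL, hB, hO⟩ a3
    simp only [Ref.eval, hn2] at hm1 hm2
    obtain ⟨K, rfl⟩ : ∃ K, m = K + 1 := ⟨m - 1, by omega⟩
    rw [Nat.add_sub_cancel] at hL hB
    let j : Fin N := ⟨K, by omega⟩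
    have hK : K = j.val := rfl
    rw [hK] at hL hB
    have hn3 : s3.ints .n = N := (a3.int .n rfl).trans hn2
    have hW3 : HoldsWeights G (s3.mem .W) := by rwa [a3.arr .W rfl]
    have hmarg : ∀ i, (fun k => matOf N (s3.mem .B) k j) ⬝ᵥ G.edgeColumn i j =
        ((G.restrict f j.val).condition i j.succ).partition / (G.restrict f j.val).partition := by
      intro i
      rw [hB, ← edgeColumn_restrict G f, marginal_eq]
    have hcond : (G.restrict f j.val).condition (f j) j.succ = G.restrict f (j.val + 1) :=
      condition_restrict G f j
    have hp : ENNReal.ofReal (Z (K + 1) / Z (K + 1 - 1)) =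
        ENNReal.ofReal ((fun k => matOf N (s3.mem .B) k j) ⬝ᵥ G.edgeColumn (f j) j) := by
      rw [hmarg, hcond]
      rfl
    rw [hp]
    refine .seq_right (.mono (sampleEdge_spec (N := N) (G := G) (j := j) (f j) (by simpa using hn3)
      (by simp [j]) hW3 (fun i => ?_) ?_) fun s4 he4 a4 => ?_)
    · rw [State.setI_mem, hmarg]
      exact div_nonneg (partition_nonneg _) (partition_nonneg _)
    · simp only [State.setI_mem, hmarg]
      exact sum_marginal (hZ _) j
    have hn4 : s4.ints .n = N := by rw [a4.int .n rfl]; simpa using hn3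
    have hj4 : s4.ints .j = j.val + 1 := by rw [a4.int .j rfl]; simp [j]
    have hW4 : HoldsWeights G (s4.mem .W) := by rw [a4.arr .W rfl]; exact hW3
    have hL4 : s4.mem .L = s3.mem .L := a4.arr .L rfl
    have hB4 : s4.mem .B = s3.mem .B := a4.arr .B rfl
    have hO4 : s4.out = s3.out := a4.out rfl
    have hc0 : ((G.restrict f j.val).condition (f j) j.succ).partition ≠ 0 := hcond ▸ hZ _
    refine .seq (.emit fun _ => ?_)
    refine .mono (condition_spec (N := N) (G := G) (j := j) (e := f j)
      (A := (G.restrict f j.val).laplacian) (B := ((G.restrict f j.val).laplacian⁻¹).transpose)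
      (u := G.edgeColumn (f j) j - fun k => (G.restrict f j.val).laplacian k j) (by simpa using hn4)
      (by simpa using hj4) (by simpa using he4) (by simpa using hW4)
      (by rw [State.emit_mem, hL4, hL]) (by rw [State.emit_mem, hB4, hB]) rfl ?_).withAgree
      fun s5 ⟨⟨hL5, hB5⟩, a5⟩ => ⟨?_, ?_, ?_⟩
    · rw [← edgeColumn_restrict G f]
      exact one_add_dotProduct_ne_zero hc0 rfl rfl
    · rw [hL5, ← edgeColumn_restrict G f, ← laplacian_condition, hcond]
      rfl
    · rw [hB5, ← edgeColumn_restrict G f, ← inv_transpose_condition hc0 rfl rfl, hcond]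
      rfl
    · intro x
      rw [a5.out rfl, State.emit_out, hO4, List.mem_append, hO, List.mem_singleton]
      simp only [Ref.eval, he4, hj4]
      constructor
      · rintro (⟨k, hk, rfl⟩ | rfl)
        · exact ⟨k, by omega, rfl⟩
        · exact ⟨j, by omega, rfl⟩
      · rintro ⟨k, hk, rfl⟩
        rcases Nat.lt_succ_iff_lt_or_eq.1 hk with h | h
        · exact Or.inl ⟨k, h, rfl⟩
        · obtain rfl : k = j := Fin.ext (by omega)
          exact Or.inr rfl

open DepSampling.Graph in
theorem le_colbournOutput {N : ℕ} (hN : 1 ≤ N) {G : Graph N}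
    {t : Finset (Fin (N + 1) × Fin (N + 1))} (ht : G.IsDependencyTree t) :
    ENNReal.ofReal (G.weight t / G.partition) ≤ colbournOutput G (some (edgeCode t)) := by
  obtain ⟨f, rfl, -, -⟩ := (isDependencyTree_iff G t).1 ht
  -- For a tree of weight zero the claimed bound is 0, and its path need not have positive
  -- probability.
  by_cases hw : G.weight (parentEdges f) = 0
  · simp [hw]
  have hpos : 0 < G.weight (parentEdges f) := lt_of_le_of_ne (weight_nonneg _ _) (Ne.symm hw)
  have hZ : ∀ m, (G.restrict f m).partition ≠ 0 := fun m =>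
    (hpos.trans_le (weight_le_partition_restrict ht m)).ne'
  obtain ⟨s, hs, -, k, hk⟩ := colbourn_spec hN hZ
  refine le_trans (ENNReal.ofReal_le_ofReal ?_) (hk.trans ?_)
  · exact div_le_div_of_nonneg_right (weight_le_partition_restrict ht N) (partition_nonneg _)
  · have := Run.le_map_apply
      (fun q : Option State × ℕ => q.1.map fun s => s.out.toFinset) (colbournRun G) (some s, k)
    simp only [Option.map_some, hs] at this
    exact this

/-! ### From lower bounds to the exact output distribution. -/

theorem edgeCode_injective {N : ℕ} : Function.Injective (edgeCode (N := N)) := by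
  refine Finset.image_injective fun a b h => ?_
  simp only [Prod.mk.injEq] at h
  exact Prod.ext (Fin.ext h.1) (Fin.ext h.2)

/-- If the values of a probability mass function are bounded below on an injective finite family by
numbers with the sum one, then the bounds are attained and there is no other mass. -/
theorem PMF_eq_of_le {α ι : Type*} (p : PMF α) (S : Finset ι) (g : ι → α)
    (hg : Function.Injective g) (b : ι → ENNReal) (hb : ∑ i ∈ S, b i = 1)
    (h : ∀ i ∈ S, b i ≤ p (g i)) :
    (∀ i ∈ S, p (g i) = b i) ∧ ∀ a ∈ p.support, ∃ i ∈ S, a = g i := by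
  classical
  have hle : ∀ T : Finset α, ∑ a ∈ T, p a ≤ 1 := fun T => p.tsum_coe ▸ ENNReal.sum_le_tsum T
  have himg : ∑ a ∈ S.image g, p a = ∑ i ∈ S, p (g i) := Finset.sum_image hg.injOn
  have hS : ∑ i ∈ S, p (g i) = 1 :=
    le_antisymm (himg ▸ hle _) (hb ▸ Finset.sum_le_sum h)
  constructor
  · intro i hi
    refine le_antisymm ?_ (h i hi)
    have h1 : p (g i) + ∑ k ∈ S.erase i, b k ≤ b i + ∑ k ∈ S.erase i, b k := by
      rw [Finset.add_sum_erase S b hi, hb, ← hS, ← Finset.add_sum_erase S (fun k => p (g k)) hi]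
      gcongr with k hk
      exact h k (Finset.mem_of_mem_erase hk)
    refine (ENNReal.add_le_add_iff_right (ne_top_of_le_ne_top ENNReal.one_ne_top ?_)).1 h1
    rw [← hb]
    exact Finset.sum_le_sum_of_subset (Finset.erase_subset i S)
  · intro a ha
    by_contra! hn
    have ha' : a ∉ S.image g := fun hm => by
      obtain ⟨i, hi, rfl⟩ := Finset.mem_image.1 hm
      exact hn i hi rfl
    have h2 := hle (insert a (S.image g))
    rw [Finset.sum_insert ha', himg, hS] at h2
    have h3 : p a + 1 ≤ 0 + 1 := by simpa using h2
    exact (p.mem_support_iff a).1 ha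
      (le_zero_iff.1 ((ENNReal.add_le_add_iff_right ENNReal.one_ne_top).1 h3))

open DepSampling.Graph in
theorem colbournOutput_eq {N : ℕ} {G : Graph N} (hG : G.partition ≠ 0) :
    (∀ o ∈ (colbournOutput G).support, ∃ t, G.IsDependencyTree t ∧ o = some (edgeCode t)) ∧
    ∀ t, G.IsDependencyTree t → colbournOutput G (some (edgeCode t)) =
      ENNReal.ofReal (1 / G.laplacian.det * ∏ e ∈ t, G.w e.1 e.2) := by
  -- A non-zero partition function provides a dependency tree, and its child of the root is a
  -- non-root node.
  have hN : 1 ≤ N := by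
    obtain ⟨t, ht, -⟩ := Finset.exists_ne_zero_of_sum_ne_zero hG
    obtain ⟨f, -, -, -, j, -⟩ := (isDependencyTree_iff G t).1 (mem_depTrees.1 ht)
    exact j.pos
  obtain ⟨h1, h2⟩ := PMF_eq_of_le (colbournOutput G) G.depTrees (fun t => some (edgeCode t))
    ((Option.some_injective _).comp edgeCode_injective)
    (fun t => ENNReal.ofReal (G.weight t / G.partition)) (by
      rw [← ENNReal.ofReal_sum_of_nonneg fun t _ =>
        div_nonneg (G.weight_nonneg t) G.partition_nonneg, ← Finset.sum_div]
      change ENNReal.ofReal (G.partition / G.partition) = 1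
      rw [div_self hG, ENNReal.ofReal_one])
    fun t ht => le_colbournOutput hN (mem_depTrees.1 ht)
  refine ⟨fun o ho => ?_, fun t ht => ?_⟩
  · obtain ⟨t, ht, rfl⟩ := h2 o ho
    exact ⟨t, mem_depTrees.1 ht, rfl⟩
  · rw [h1 t (mem_depTrees.2 ht), partition_eq_det hN, div_eq_mul_one_div, mul_comm, weight]

end DepSampling

theorem mainTheorem1 :
    -- running time: every run, on every graph, takes O(N³) steps
    (∃ K : ℕ, ∀ (N : ℕ), 1 ≤ N → ∀ (G : DepSampling.Graph N),
      ∀ q ∈ (DepSampling.colbournRun G).support, q.2 ≤ K * N ^ 3) ∧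
    -- the normalization constant is the determinant of the root-constrained Laplacian
    (∀ (N : ℕ), 1 ≤ N → ∀ (G : DepSampling.Graph N), G.partition = G.laplacian.det) ∧
    -- correctness of the sampler
    (∀ (N : ℕ) (G : DepSampling.Graph N), G.partition ≠ 0 →
      (∀ o ∈ (DepSampling.colbournOutput G).support,
        ∃ t, G.IsDependencyTree t ∧ o = some (DepSampling.edgeCode t)) ∧
      (∀ t, G.IsDependencyTree t →
        DepSampling.colbournOutput G (some (DepSampling.edgeCode t)) =
          ENNReal.ofReal (1 / G.laplacian.det * ∏ e ∈ t, G.w e.1 e.2))) ∧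
    -- conditioning on an edge: column replacement and rank-one update of the transposed inverse
    (∀ (N : ℕ) (G : DepSampling.Graph N) (i : Fin (N + 1)) (j : Fin N), (i, j.succ) ∈ G.edges →
      (∀ t, (G.condition i j.succ).IsDependencyTree t ↔
        G.IsDependencyTree t ∧ (i, j.succ) ∈ t) ∧
      (G.condition i j.succ).laplacian = G.laplacian.updateCol j (G.edgeColumn i j) ∧
      ((G.condition i j.succ).partition ≠ 0 →
        ∀ (B : Matrix (Fin N) (Fin N) ℝ) (u : Fin N → ℝ),
          B = (G.laplacian⁻¹).transpose →
          u = G.edgeColumn i j - (fun k => G.laplacian k j) →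
          1 + u ⬝ᵥ (fun k => B k j) ≠ 0 ∧
          ((G.condition i j.succ).laplacian⁻¹).transpose =
            B - (1 / (1 + u ⬝ᵥ (fun k => B k j))) •
              Matrix.vecMulVec (fun k => B k j) (Matrix.vecMul u B))) := by
  refine ⟨⟨10000, fun N hN G q hq => DepSampling.colbournRun_cost_le hN G hq⟩,
    fun N hN G => DepSampling.Graph.partition_eq_det hN G,
    fun N G hG => DepSampling.colbournOutput_eq hG,
    fun N G i j _ => ⟨DepSampling.Graph.isDependencyTree_condition_iff G i j,
      DepSampling.Graph.laplacian_condition G i j, fun h B u hB hu =>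
        ⟨DepSampling.Graph.one_add_dotProduct_ne_zero h hB hu,
          DepSampling.Graph.inv_transpose_condition h hB hu⟩⟩⟩
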